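/- Let $(M,g)$ be a smooth $3$-dimensional Riemannian manifold (without boundary; completeness, connectedness and orientability are not assumed) which is flat, i.e. whose Riemann curvature tensor vanishes identically. Let $\mathbb S^2\subset\mathbb R^3$ be the unit sphere with its round metric $h$ (the restriction of the Euclidean scalar product), and let $F:\mathbb S^2\to M$ be a smooth isometric immersion, i.e. a smooth map with $F^*g=h$. Then $F$ is totally umbilical: for every $p\in\mathbb S^2$ and every vector $\nu\in T_{F(p)}M$ orthogonal to $dF_p(T_p\mathbb S^2)$ there is a real number $\mu$ such that $$\mathrm{II}_\nu(v,w)=\mu\, g(dF_p v,dF_p w)\qquad\text{for all } v,w\in T_p\mathbb S^2,$$ where $\mathrm{II}_\nu(v,w)=g(\nabla_v (dF\,W),\nu)$ is the second fundamental form of $F$ in the direction $\nu$, with $\nabla$ the Levi-Civita connection of $g$ (pulled back along $F$) and $W$ any local vector field on $\mathbb S^2$ with $W(p)=w$. -/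

import Mathlib

open scoped Manifold ContDiff Bundle

noncomputable section

namespace FlatImmersion

/-- A smooth Riemannian metric on a smooth manifold `M` of dimension `n` (without boundary). -/
abbrev RiemMetric (n : ℕ) (M : Type*) [TopologicalSpace M]
    [ChartedSpace (EuclideanSpace ℝ (Fin n)) M] [IsManifold (𝓡 n) ∞ M] :=
  Bundle.ContMDiffRiemannianMetric (𝓡 n) ∞ (EuclideanSpace ℝ (Fin n))
    (fun x : M => TangentSpace (𝓡 n) x)

/-- The expression of the metric `g` in the chart of `M` around `x₀`: at a point `y` of the target
of the chart `φ` it is the bilinear form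
`(v, w) ↦ g (d(φ⁻¹)_y v, d(φ⁻¹)_y w)`. -/
def chartMetric {n : ℕ} {M : Type*} [TopologicalSpace M]
    [ChartedSpace (EuclideanSpace ℝ (Fin n)) M] [IsManifold (𝓡 n) ∞ M]
    (g : RiemMetric n M) (x₀ : M) (y : EuclideanSpace ℝ (Fin n)) :
    EuclideanSpace ℝ (Fin n) →L[ℝ] EuclideanSpace ℝ (Fin n) →L[ℝ] ℝ :=
  -- the tangent spaces of `M` are by definition copies of the model vector space
  let A : EuclideanSpace ℝ (Fin n) →L[ℝ] EuclideanSpace ℝ (Fin n) :=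
    mfderiv (𝓘(ℝ, EuclideanSpace ℝ (Fin n))) (𝓡 n) (extChartAt (𝓡 n) x₀).symm y
  let B : EuclideanSpace ℝ (Fin n) →L[ℝ] EuclideanSpace ℝ (Fin n) →L[ℝ] ℝ :=
    g.inner ((extChartAt (𝓡 n) x₀).symm y)
  B.bilinearComp A A

/-- The Christoffel symbols of a metric `G` given on an open set of a vector space, as a
vector-valued map: `Γ = christoffel G y v w` is the vector such that, for all `z`,
`G y Γ z = ½ (∂_v G (w, z) + ∂_w G (v, z) - ∂_z G (v, w))` at `y`. Here `(G y).inverse` is the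
inverse of the isomorphism from vectors to covectors given by the nondegenerate form `G y`. -/
def christoffel {E : Type*} [NormedAddCommGroup E] [NormedSpace ℝ E]
    (G : E → E →L[ℝ] E →L[ℝ] ℝ) (y v w : E) : E :=
  (G y).inverse ((1 / 2 : ℝ) •
    (fderiv ℝ G y v w + fderiv ℝ G y w v - ((fderiv ℝ G y).flip v).flip w))

/-- The Riemann curvature `R(a, b)c = ∇_a ∇_b c - ∇_b ∇_a c` (for constant vector fields
`a, b, c`) of the Levi-Civita connection of a metric `G` given on an open set of a vector space. -/
def curvature {E : Type*} [NormedAddCommGroup E] [NormedSpace ℝ E]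
    (G : E → E →L[ℝ] E →L[ℝ] ℝ) (y a b c : E) : E :=
  fderiv ℝ (fun x => christoffel G x b c) y a - fderiv ℝ (fun x => christoffel G x a c) y b
    + christoffel G y a (christoffel G y b c) - christoffel G y b (christoffel G y a c)

/-- A Riemannian metric is flat if its Riemann curvature tensor vanishes identically (computed in
the charts of the manifold). -/
def IsFlat {n : ℕ} {M : Type*} [TopologicalSpace M]
    [ChartedSpace (EuclideanSpace ℝ (Fin n)) M] [IsManifold (𝓡 n) ∞ M]
    (g : RiemMetric n M) : Prop :=
  ∀ x₀ : M, ∀ y ∈ (extChartAt (𝓡 n) x₀).target, ∀ a b c : EuclideanSpace ℝ (Fin n),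
    curvature (chartMetric g x₀) y a b c = 0

/-- The unit sphere of Euclidean `3`-space. -/
abbrev S2 : Type := Metric.sphere (0 : EuclideanSpace ℝ (Fin 3)) 1

/-- The round metric of the unit sphere: the restriction of the Euclidean scalar product. -/
def roundMetric (p : S2) (v w : TangentSpace (𝓡 2) p) : ℝ :=
  inner ℝ
    (mfderiv (𝓡 2) (𝓘(ℝ, EuclideanSpace ℝ (Fin 3)))
      (fun x : S2 => (x : EuclideanSpace ℝ (Fin 3))) p v : EuclideanSpace ℝ (Fin 3))
    (mfderiv (𝓡 2) (𝓘(ℝ, EuclideanSpace ℝ (Fin 3)))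
      (fun x : S2 => (x : EuclideanSpace ℝ (Fin 3))) p w : EuclideanSpace ℝ (Fin 3))

/-- A smooth isometric immersion of the round sphere into a Riemannian manifold: a smooth map which
pulls back the metric to the round metric (its differential is therefore injective). -/
def IsIsometricImmersion {n : ℕ} {M : Type*} [TopologicalSpace M]
    [ChartedSpace (EuclideanSpace ℝ (Fin n)) M] [IsManifold (𝓡 n) ∞ M]
    (g : RiemMetric n M) (F : S2 → M) : Prop :=
  ContMDiff (𝓡 2) (𝓡 n) ∞ F ∧
    ∀ (p : S2) (v w : TangentSpace (𝓡 2) p),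
      g.inner (F p) (mfderiv (𝓡 2) (𝓡 n) F p v) (mfderiv (𝓡 2) (𝓡 n) F p w) = roundMetric p v w

/-- The expression of `F` in the charts of the sphere around `p` and of `M` around `F p`. -/
def localExpr {n : ℕ} {M : Type*} [TopologicalSpace M]
    [ChartedSpace (EuclideanSpace ℝ (Fin n)) M] (F : S2 → M) (p : S2)
    (x : EuclideanSpace ℝ (Fin 2)) : EuclideanSpace ℝ (Fin n) :=
  extChartAt (𝓡 n) (F p) (F ((extChartAt (𝓡 2) p).symm x))

/-- In the charts around `p` and `F p`, with `u` the local expression of `F`: the covariant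
derivative at `p` of the vector field `dF(b)` along `F` in the direction `a`, for constant `a, b`,
that is `∂_a ∂_b u + Γ(u)(∂_a u, ∂_b u)`, where `Γ` are the Christoffel symbols of `g`. -/
def covDerivAlong {n : ℕ} {M : Type*} [TopologicalSpace M]
    [ChartedSpace (EuclideanSpace ℝ (Fin n)) M] [IsManifold (𝓡 n) ∞ M]
    (g : RiemMetric n M) (F : S2 → M) (p : S2) (a b : EuclideanSpace ℝ (Fin 2)) :
    EuclideanSpace ℝ (Fin n) :=
  fderiv ℝ (fderiv ℝ (localExpr F p)) (extChartAt (𝓡 2) p p) a b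
    + christoffel (chartMetric g (F p)) (extChartAt (𝓡 n) (F p) (F p))
        (fderiv ℝ (localExpr F p) (extChartAt (𝓡 2) p p) a)
        (fderiv ℝ (localExpr F p) (extChartAt (𝓡 2) p p) b)

/-- The second fundamental form of `F` at `p` in the direction of a vector `ν` normal to `F`:
`II_ν(v, w) = g(∇_v dF(W), ν)`, where `W` is any extension of `w` to a vector field (since `ν` is
normal, this does not depend on the extension, and the one constant in the chart is used). -/
def secondFundForm {n : ℕ} {M : Type*} [TopologicalSpace M]
    [ChartedSpace (EuclideanSpace ℝ (Fin n)) M] [IsManifold (𝓡 n) ∞ M]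
    (g : RiemMetric n M) (F : S2 → M) (p : S2) (ν : TangentSpace (𝓡 n) (F p))
    (v w : TangentSpace (𝓡 2) p) : ℝ :=
  chartMetric g (F p) (extChartAt (𝓡 n) (F p) (F p))
    (covDerivAlong g F p
      (mfderiv (𝓡 2) (𝓘(ℝ, EuclideanSpace ℝ (Fin 2))) (extChartAt (𝓡 2) p) p v)
      (mfderiv (𝓡 2) (𝓘(ℝ, EuclideanSpace ℝ (Fin 2))) (extChartAt (𝓡 2) p) p w))
    (mfderiv (𝓡 n) (𝓘(ℝ, EuclideanSpace ℝ (Fin n))) (extChartAt (𝓡 n) (F p)) (F p) ν)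

/-- `F` is totally umbilical if at every point `p`, and for every vector `ν` normal to `F` at `p`,
the second fundamental form in the direction `ν` is a multiple of the induced metric (equivalently,
the shape operator of `ν` is a multiple of the identity). -/
def IsTotallyUmbilical {n : ℕ} {M : Type*} [TopologicalSpace M]
    [ChartedSpace (EuclideanSpace ℝ (Fin n)) M] [IsManifold (𝓡 n) ∞ M]
    (g : RiemMetric n M) (F : S2 → M) : Prop :=
  ∀ (p : S2) (ν : TangentSpace (𝓡 n) (F p)),
    (∀ v : TangentSpace (𝓡 2) p, g.inner (F p) (mfderiv (𝓡 2) (𝓡 n) F p v) ν = 0) →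
    ∃ μ : ℝ, ∀ v w : TangentSpace (𝓡 2) p,
      secondFundForm g F p ν v w =
        μ * g.inner (F p) (mfderiv (𝓡 2) (𝓡 n) F p v) (mfderiv (𝓡 2) (𝓡 n) F p w)

end FlatImmersion

end

/-!
Every isometric immersion of the unit sphere in a flat Riemannian `3`-manifold is totally umbilical.

The argument is the classical one for surfaces of constant Gaussian curvature `1`, by the maximum
principle. In a stereographic chart the round metric is `lam * (dx² + dy²)` with
`lam = 16 / (|x|² + 4)²` (`roundFactor`). Write the second fundamental form, with respect to a local
unit normal, as `lam * H` times the identity plus the traceless matrix `(A, M; M, -A)`. Since the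
ambient curvature vanishes, the third covariant derivatives of the immersion are symmetric
(`IsothermalSurface.covDeriv_hess_comm`), which gives the equations of Codazzi,
`∂₁A + ∂₂M = lam * ∂₁H` and `∂₁M - ∂₂A = lam * ∂₂H` (`IsothermalSurface.codazzi₁`,
`IsothermalSurface.codazzi₂`), and of Gauss, `A² + M² = lam² * (H² - 1)`, which says that the
determinant of the second fundamental form is `lam²` (`IsothermalSurface.gauss_round`).

Suppose that `H > 0` has a local maximum at the centre of the chart, where `lam = 1` to first order.
The differentiated Gauss equation and the Codazzi equations say that `A` and `M` are critical there
unless `A = M = 0`. Differentiating twice then gives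
`(H - A) * ∂₁₁H - 2 * M * ∂₁₂H + (H + A) * ∂₂₂H = 2 * (H² - 1) = 2 * (A² + M²)`.
The coefficient matrix on the left has determinant `H² - A² - M² = 1` and is positive definite, and
the Hessian of `H` is negative semidefinite; so `A = M = 0` and `H = 1` (`umbilic_of_isLocalMax`).

A global normal field need not exist, but `H²` does not depend on the normal, and not on the charts
either (`apply_hess_trace_eq`). So it is a continuous function on the sphere
(`continuous_meanCurvatureSq`), which attains its maximum by compactness. Hence `H² ≤ 1` everywhere
(`meanCurvatureSq_le`), and `A² + M² = lam² * (H² - 1)` forces `A = M = 0` at every point.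
-/

noncomputable section

namespace FlatImmersion

set_option linter.unusedSectionVars false

/-! ### The Levi-Civita connection of a metric on an open set of a vector space -/

section connection

set_option synthInstance.maxHeartbeats 100000

variable {V : Type*} [NormedAddCommGroup V] [NormedSpace ℝ V] [FiniteDimensional ℝ V]
  {P : Type*} [NormedAddCommGroup P] [NormedSpace ℝ P]

/-- `G` is a smooth Riemannian metric on the open set `Ω` of a vector space. -/
structure IsMetricOn (G : V → V →L[ℝ] V →L[ℝ] ℝ) (Ω : Set V) : Prop where
  isOpen : IsOpen Ω
  contDiffOn : ContDiffOn ℝ ∞ G Ω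
  symm : ∀ y ∈ Ω, ∀ v w, G y v w = G y w v
  pos : ∀ y ∈ Ω, ∀ v, v ≠ 0 → 0 < G y v v

namespace IsMetricOn

variable {G : V → V →L[ℝ] V →L[ℝ] ℝ} {Ω : Set V} {y : V}

theorem contDiffAt (h : IsMetricOn G Ω) (hy : y ∈ Ω) : ContDiffAt ℝ ∞ G y :=
  h.contDiffOn.contDiffAt (h.isOpen.mem_nhds hy)

theorem differentiableAt (h : IsMetricOn G Ω) (hy : y ∈ Ω) : DifferentiableAt ℝ G y :=
  (h.contDiffAt hy).differentiableAt (by simp)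

/-- The metric is nondegenerate. -/
theorem eq_of_forall (h : IsMetricOn G Ω) (hy : y ∈ Ω) {v w : V}
    (H : ∀ z, G y v z = G y w z) : v = w := by
  by_contra hne
  have := h.pos y hy (v - w) (sub_ne_zero.2 hne)
  have h0 : G y (v - w) = 0 := by
    ext z
    simp [H]
  simp [h0] at this

theorem isInvertible (h : IsMetricOn G Ω) (hy : y ∈ Ω) : (G y).IsInvertible := by
  have hinj : Function.Injective (G y : V →ₗ[ℝ] V →L[ℝ] ℝ) := fun v w hvw =>
    h.eq_of_forall hy fun z => congrArg (fun φ : V →L[ℝ] ℝ => φ z) hvw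
  have hfin : Module.finrank ℝ V = Module.finrank ℝ (V →L[ℝ] ℝ) := by
    rw [← (LinearMap.toContinuousLinearMap : (V →ₗ[ℝ] ℝ) ≃ₗ[ℝ] V →L[ℝ] ℝ).finrank_eq]
    exact (Subspace.dual_finrank_eq).symm
  refine ⟨(LinearEquiv.ofInjectiveOfFinrankEq _ hinj hfin).toContinuousLinearEquiv, ?_⟩
  ext v w
  rfl

theorem fderiv_symm (h : IsMetricOn G Ω) (hy : y ∈ Ω) (a v w : V) :
    fderiv ℝ G y a v w = fderiv ℝ G y a w v := by
  have h1 : ∀ v w : V, fderiv ℝ (fun x => G x v w) y a = fderiv ℝ G y a v w := by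
    intro v w
    have h2 := ((h.differentiableAt hy).hasFDerivAt.clm_apply
      (hasFDerivAt_const v y)).clm_apply (hasFDerivAt_const w y)
    rw [h2.fderiv]
    simp
  have h2 : (fun x => G x v w) =ᶠ[nhds y] fun x => G x w v := by
    filter_upwards [h.isOpen.mem_nhds hy] with x hx using h.symm x hx v w
  rw [← h1, ← h1, h2.fderiv_eq]

/-- The Koszul formula. -/
theorem apply_christoffel (h : IsMetricOn G Ω) (hy : y ∈ Ω) (v w z : V) :
    G y (christoffel G y v w) z =
      (1 / 2) * (fderiv ℝ G y v w z + fderiv ℝ G y w v z - fderiv ℝ G y z v w) := by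
  rw [christoffel, (h.isInvertible hy).self_apply_inverse]
  simp

theorem christoffel_comm (h : IsMetricOn G Ω) (hy : y ∈ Ω) (v w : V) :
    christoffel G y v w = christoffel G y w v := by
  refine h.eq_of_forall hy fun z => ?_
  rw [h.apply_christoffel hy, h.apply_christoffel hy, h.fderiv_symm hy z v w]
  ring

/-- The Levi-Civita connection is compatible with the metric. -/
theorem fderiv_eq_christoffel (h : IsMetricOn G Ω) (hy : y ∈ Ω) (a v w : V) :
    fderiv ℝ G y a v w = G y (christoffel G y a v) w + G y v (christoffel G y a w) := by
  rw [h.symm y hy v, h.apply_christoffel hy, h.apply_christoffel hy]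
  linarith [h.fderiv_symm hy a w v, h.fderiv_symm hy v a w, h.fderiv_symm hy w v a]

end IsMetricOn

section

variable {G : V → V →L[ℝ] V →L[ℝ] ℝ} {Ω : Set V} {y : V}

theorem christoffel_add_left (y v v' w : V) :
    christoffel G y (v + v') w = christoffel G y v w + christoffel G y v' w := by
  simp only [christoffel, ← map_add, ← smul_add]
  congr 2
  ext z
  simp
  ring

theorem christoffel_smul_left (y : V) (t : ℝ) (v w : V) :
    christoffel G y (t • v) w = t • christoffel G y v w := by
  rw [christoffel, christoffel, ← map_smul, smul_comm t]
  congr 2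
  ext z
  simp
  ring

theorem christoffel_add_right (y v w w' : V) :
    christoffel G y v (w + w') = christoffel G y v w + christoffel G y v w' := by
  simp only [christoffel, ← map_add, ← smul_add]
  congr 2
  ext z
  simp
  ring

theorem christoffel_smul_right (y : V) (t : ℝ) (v w : V) :
    christoffel G y v (t • w) = t • christoffel G y v w := by
  rw [christoffel, christoffel, ← map_smul, smul_comm t]
  congr 2
  ext z
  simp
  ring

theorem contDiffAt_fderiv_apply {Q W : Type*} [NormedAddCommGroup Q] [NormedSpace ℝ Q]
    [NormedAddCommGroup W] [NormedSpace ℝ W] {f : P → W} {g v : Q → P} {q : Q}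
    (hf : ContDiffAt ℝ ∞ f (g q)) (hg : ContDiffAt ℝ ∞ g q) (hv : ContDiffAt ℝ ∞ v q) :
    ContDiffAt ℝ ∞ (fun q => fderiv ℝ f (g q) (v q)) q :=
  (ContDiffAt.comp q (hf.fderiv_right (m := ∞) le_rfl) hg).clm_apply hv

/-- The Christoffel symbols depend smoothly on the point and on both vectors jointly. -/
theorem IsMetricOn.contDiffAt_christoffel (h : IsMetricOn G Ω) (hy : y ∈ Ω) (v w : V) :
    ContDiffAt ℝ ∞ (fun q : V × V × V => christoffel G q.1 q.2.1 q.2.2) (y, v, w) := by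
  have hopen : IsOpen ((fun q : V × V × V => q.1) ⁻¹' Ω) := h.isOpen.preimage continuous_fst
  have hfst : ∀ q : V × V × V, ContDiffAt ℝ ∞ (fun q : V × V × V => q.1) q :=
    fun q => contDiffAt_fst
  have hv : ∀ q : V × V × V, ContDiffAt ℝ ∞ (fun q : V × V × V => q.2.1) q :=
    fun q => contDiffAt_fst.comp q contDiffAt_snd
  have hw : ∀ q : V × V × V, ContDiffAt ℝ ∞ (fun q : V × V × V => q.2.2) q :=
    fun q => contDiffAt_snd.comp q contDiffAt_snd
  have hflip : ContDiffOn ℝ ∞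
      (fun q : V × V × V => ((fderiv ℝ G q.1).flip q.2.1).flip q.2.2)
      ((fun q : V × V × V => q.1) ⁻¹' Ω) := by
    refine contDiffOn_clm_apply.2 fun z q hq => ContDiffAt.contDiffWithinAt ?_
    exact ((contDiffAt_fderiv_apply (h.contDiffAt hq) (hfst q)
      (contDiffAt_const (c := z))).clm_apply (hv q)).clm_apply (hw q)
  have h1 : ContDiffAt ℝ ∞ (fun q : V × V × V => (G q.1).inverse) (y, v, w) :=
    ContDiffAt.comp (g := ContinuousLinearMap.inverse) (f := fun q : V × V × V => G q.1) _
      (h.isInvertible hy).contDiffAt_map_inverse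
      (ContDiffAt.comp (g := G) (f := fun q : V × V × V => q.1) _ (h.contDiffAt hy) contDiffAt_fst)
  have hvw := (contDiffAt_fderiv_apply (q := (y, v, w)) (h.contDiffAt hy) (hfst _)
    (hv _)).clm_apply (hw _)
  have hwv := (contDiffAt_fderiv_apply (q := (y, v, w)) (h.contDiffAt hy) (hfst _)
    (hw _)).clm_apply (hv _)
  exact h1.clm_apply (((hvw.add hwv).sub
    (hflip.contDiffAt (hopen.mem_nhds hy))).const_smul (1 / 2 : ℝ))

/-- The product rule for the Christoffel symbols: `christoffel G` is nonlinear in the point, and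
linear in each of the two vectors. -/
theorem IsMetricOn.fderiv_christoffel_comp (h : IsMetricOn G Ω) {Y v w : P → V} {x : P}
    (hx : Y x ∈ Ω) (hY : DifferentiableAt ℝ Y x) (hv : DifferentiableAt ℝ v x)
    (hw : DifferentiableAt ℝ w x) (a : P) :
    DifferentiableAt ℝ (fun x => christoffel G (Y x) (v x) (w x)) x ∧
    fderiv ℝ (fun x => christoffel G (Y x) (v x) (w x)) x a =
      fderiv ℝ (fun y => christoffel G y (v x) (w x)) (Y x) (fderiv ℝ Y x a) +
        christoffel G (Y x) (fderiv ℝ v x a) (w x) +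
        christoffel G (Y x) (v x) (fderiv ℝ w x a) := by
  have hF := ((h.contDiffAt_christoffel hx (v x) (w x)).differentiableAt (by simp)).hasFDerivAt
  set L := fderiv ℝ (fun q : V × V × V => christoffel G q.1 q.2.1 q.2.2) (Y x, v x, w x)
  have h0 : HasFDerivAt (fun x => christoffel G (Y x) (v x) (w x))
      (L ∘L ((fderiv ℝ Y x).prod ((fderiv ℝ v x).prod (fderiv ℝ w x)))) x :=
    HasFDerivAt.comp (g := fun q : V × V × V => christoffel G q.1 q.2.1 q.2.2)
      (f := fun x => (Y x, v x, w x)) x hF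
      (hY.hasFDerivAt.prodMk (hv.hasFDerivAt.prodMk hw.hasFDerivAt))
  refine ⟨h0.differentiableAt, ?_⟩
  have h1 : HasFDerivAt (fun y => christoffel G y (v x) (w x))
      (L ∘L ((ContinuousLinearMap.id ℝ V).prod 0)) (Y x) :=
    HasFDerivAt.comp (g := fun q : V × V × V => christoffel G q.1 q.2.1 q.2.2)
      (f := fun y => (y, v x, w x)) (Y x) hF
      ((hasFDerivAt_id (Y x)).prodMk (hasFDerivAt_const (v x, w x) (Y x)))
  -- the partial derivatives of `christoffel G` in its linear arguments, computed along lines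
  have h2 : L (0, fderiv ℝ v x a, 0) = christoffel G (Y x) (fderiv ℝ v x a) (w x) := by
    have h3 : HasDerivAt (fun t : ℝ => ((Y x, v x + t • fderiv ℝ v x a, w x) : V × V × V))
        (0, fderiv ℝ v x a, 0) 0 := by
      have h5 : HasDerivAt (fun t : ℝ => v x + t • fderiv ℝ v x a) (fderiv ℝ v x a) 0 := by
        simpa using ((hasDerivAt_id (0 : ℝ)).smul_const (fderiv ℝ v x a)).const_add (v x)
      exact (hasDerivAt_const _ _).prodMk (h5.prodMk (hasDerivAt_const _ _))
    have h4 : HasDerivAt (fun t : ℝ => christoffel G (Y x) (v x + t • fderiv ℝ v x a) (w x))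
        (L (0, fderiv ℝ v x a, 0)) 0 := by
      refine HasFDerivAt.comp_hasDerivAt
        (l := fun q : V × V × V => christoffel G q.1 q.2.1 q.2.2) (0 : ℝ) ?_ h3
      simpa using hF
    simp only [christoffel_add_left, christoffel_smul_left] at h4
    refine h4.unique ?_
    simpa using ((hasDerivAt_id (0 : ℝ)).smul_const
      (christoffel G (Y x) (fderiv ℝ v x a) (w x))).const_add
      (christoffel G (Y x) (v x) (w x))
  have h3 : L (0, 0, fderiv ℝ w x a) = christoffel G (Y x) (v x) (fderiv ℝ w x a) := by
    have h3 : HasDerivAt (fun t : ℝ => ((Y x, v x, w x + t • fderiv ℝ w x a) : V × V × V))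
        (0, 0, fderiv ℝ w x a) 0 := by
      have h5 : HasDerivAt (fun t : ℝ => w x + t • fderiv ℝ w x a) (fderiv ℝ w x a) 0 := by
        simpa using ((hasDerivAt_id (0 : ℝ)).smul_const (fderiv ℝ w x a)).const_add (w x)
      exact (hasDerivAt_const _ _).prodMk ((hasDerivAt_const _ _).prodMk h5)
    have h4 : HasDerivAt (fun t : ℝ => christoffel G (Y x) (v x) (w x + t • fderiv ℝ w x a))
        (L (0, 0, fderiv ℝ w x a)) 0 := by
      refine HasFDerivAt.comp_hasDerivAt
        (l := fun q : V × V × V => christoffel G q.1 q.2.1 q.2.2) (0 : ℝ) ?_ h3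
      simpa using hF
    simp only [christoffel_add_right, christoffel_smul_right] at h4
    refine h4.unique ?_
    simpa using ((hasDerivAt_id (0 : ℝ)).smul_const
      (christoffel G (Y x) (v x) (fderiv ℝ w x a))).const_add
      (christoffel G (Y x) (v x) (w x))
  rw [h0.fderiv, h1.fderiv, ← h2, ← h3]
  simp only [ContinuousLinearMap.comp_apply, ContinuousLinearMap.prod_apply, ← map_add]
  simp

end

/-- The covariant derivative, in the direction `a`, of the vector field `X` along the map `u`. -/
def covDeriv (G : V → V →L[ℝ] V →L[ℝ] ℝ) (u : P → V) (a : P) (X : P → V) (x : P) : V :=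
  fderiv ℝ X x a + christoffel G (u x) (fderiv ℝ u x a) (X x)

/-- The Hessian of the map `u` with values in a Riemannian manifold, for the flat connection on
the source: the covariant derivative of `∂_b u` in the direction `a`. -/
def hess (G : V → V →L[ℝ] V →L[ℝ] ℝ) (u : P → V) (x a b : P) : V :=
  fderiv ℝ (fderiv ℝ u) x a b + christoffel G (u x) (fderiv ℝ u x a) (fderiv ℝ u x b)

section

variable {G : V → V →L[ℝ] V →L[ℝ] ℝ} {Ω : Set V} {u : P → V} {x : P}

theorem covDeriv_fderiv (hu : ContDiffAt ℝ ∞ u x) (a b : P) :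
    covDeriv G u a (fun x => fderiv ℝ u x b) x = hess G u x a b := by
  have h1 : DifferentiableAt ℝ (fderiv ℝ u) x :=
    (hu.fderiv_right (m := 1) (by norm_cast)).differentiableAt (by simp)
  have h2 := (h1.hasFDerivAt.clm_apply (hasFDerivAt_const b x)).fderiv
  simp [covDeriv, hess, h2]

/-- The Levi-Civita connection is torsion free. -/
theorem hess_comm (h : IsMetricOn G Ω) (hx : u x ∈ Ω) (hu : ContDiffAt ℝ ∞ u x) (a b : P) :
    hess G u x a b = hess G u x b a := by
  have := (hu.isSymmSndFDerivAt (by simpa using ENat.LEInfty.out)).eq a b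
  rw [hess, hess, this, h.christoffel_comm hx]

/-- Compatibility of the connection with the metric, for vector fields along a map. -/
theorem fderiv_metric (h : IsMetricOn G Ω) (hx : u x ∈ Ω) (hu : DifferentiableAt ℝ u x)
    {X Y : P → V} (hX : DifferentiableAt ℝ X x) (hY : DifferentiableAt ℝ Y x) (a : P) :
    fderiv ℝ (fun x => G (u x) (X x) (Y x)) x a =
      G (u x) (covDeriv G u a X x) (Y x) + G (u x) (X x) (covDeriv G u a Y x) := by
  have h1 := HasFDerivAt.comp (g := G) (f := u) x (h.differentiableAt hx).hasFDerivAt hu.hasFDerivAt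
  have h2 := ((h1.clm_apply hX.hasFDerivAt).clm_apply hY.hasFDerivAt).fderiv
  simp only [Function.comp_def] at h2
  rw [h2]
  simp only [covDeriv, add_apply, ContinuousLinearMap.comp_apply,
    ContinuousLinearMap.flip_apply, map_add, h.fderiv_eq_christoffel hx]
  ring

theorem contDiffAt_covDeriv (h : IsMetricOn G Ω) (hx : u x ∈ Ω) (hu : ContDiffAt ℝ ∞ u x)
    {X : P → V} (hX : ContDiffAt ℝ ∞ X x) (a : P) : ContDiffAt ℝ ∞ (covDeriv G u a X) x := by
  have h2 : ContDiffAt ℝ ∞ (fun x => fderiv ℝ u x a) x :=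
    (hu.fderiv_right (by simp)).clm_apply contDiffAt_const
  have h3 : ContDiffAt ℝ ∞ (fun x => fderiv ℝ X x a) x :=
    (hX.fderiv_right (by simp)).clm_apply contDiffAt_const
  exact h3.add (ContDiffAt.comp (g := fun q : V × V × V => christoffel G q.1 q.2.1 q.2.2)
    (f := fun x => (u x, fderiv ℝ u x a, X x)) x
    (h.contDiffAt_christoffel hx (fderiv ℝ u x a) (X x)) (hu.prodMk (h2.prodMk hX)))

/-- In a flat manifold, covariant derivatives along a map in the directions of constant vectors
commute. -/
theorem covDeriv_comm (h : IsMetricOn G Ω) (hx : u x ∈ Ω) (hu : ContDiffAt ℝ ∞ u x)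
    (hflat : ∀ a b c, curvature G (u x) a b c = 0)
    {X : P → V} (hX : ContDiffAt ℝ ∞ X x) (a b : P) :
    covDeriv G u a (covDeriv G u b X) x = covDeriv G u b (covDeriv G u a X) x := by
  have hud : DifferentiableAt ℝ u x := hu.differentiableAt (by simp)
  have hfu : DifferentiableAt ℝ (fderiv ℝ u) x :=
    (hu.fderiv_right (m := 1) (by norm_cast)).differentiableAt (by simp)
  have hfX : DifferentiableAt ℝ (fderiv ℝ X) x :=
    (hX.fderiv_right (m := 1) (by norm_cast)).differentiableAt (by simp)
  have hXd : DifferentiableAt ℝ X x := hX.differentiableAt (by simp)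
  -- the second covariant derivative, fully expanded
  have key : ∀ a b : P, covDeriv G u a (covDeriv G u b X) x =
      fderiv ℝ (fderiv ℝ X) x a b +
      (fderiv ℝ (fun y => christoffel G y (fderiv ℝ u x b) (X x)) (u x) (fderiv ℝ u x a) +
        christoffel G (u x) (fderiv ℝ (fderiv ℝ u) x a b) (X x) +
        christoffel G (u x) (fderiv ℝ u x b) (fderiv ℝ X x a)) +
      (christoffel G (u x) (fderiv ℝ u x a) (fderiv ℝ X x b) +
        christoffel G (u x) (fderiv ℝ u x a)
          (christoffel G (u x) (fderiv ℝ u x b) (X x))) := by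
    intro a b
    have h1 := hfX.hasFDerivAt.clm_apply (hasFDerivAt_const b x)
    have h2 := hfu.hasFDerivAt.clm_apply (hasFDerivAt_const b x)
    obtain ⟨h3, h4⟩ := h.fderiv_christoffel_comp hx hud h2.differentiableAt hXd a
    have h5 : fderiv ℝ (covDeriv G u b X) x a = fderiv ℝ (fderiv ℝ X) x a b +
        fderiv ℝ (fun x => christoffel G (u x) (fderiv ℝ u x b) (X x)) x a := by
      have := (h1.add h3.hasFDerivAt).fderiv
      change fderiv ℝ (fun y => fderiv ℝ X y b +
        christoffel G (u y) (fderiv ℝ u y b) (X y)) x a = _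
      change fderiv ℝ (fun y => fderiv ℝ X y b +
        christoffel G (u y) (fderiv ℝ u y b) (X y)) x = _ at this
      rw [this]
      simp
    rw [covDeriv, h5, h4, h2.fderiv]
    simp [covDeriv, christoffel_add_right]
  have h5 := hflat (fderiv ℝ u x a) (fderiv ℝ u x b) (X x)
  rw [curvature] at h5
  rw [key, key, (hu.isSymmSndFDerivAt (by simpa using ENat.LEInfty.out)).eq a b,
    (hX.isSymmSndFDerivAt (by simpa using ENat.LEInfty.out)).eq a b, ← sub_eq_zero, ← h5]
  abel

end

end connection

/-! ### The equations of Gauss and Codazzi in isothermal coordinates -/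

section isothermal

variable {V : Type*} [NormedAddCommGroup V] [NormedSpace ℝ V] [FiniteDimensional ℝ V]
  {P : Type*} [NormedAddCommGroup P] [NormedSpace ℝ P]
  {Q : Type*} [NormedAddCommGroup Q] [NormedSpace ℝ Q]

theorem differentiableAt_fderiv {W : Type*} [NormedAddCommGroup W] [NormedSpace ℝ W] {f : P → W}
    {x : P} (hf : ContDiffAt ℝ ∞ f x) : DifferentiableAt ℝ (fderiv ℝ f) x :=
  (hf.fderiv_right (m := 1) (by norm_cast)).differentiableAt (by simp)

theorem eventually_differentiableAt {W : Type*} [NormedAddCommGroup W] [NormedSpace ℝ W] {f : P → W}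
    {x : P} (hf : ContDiffAt ℝ ∞ f x) : ∀ᶠ y in nhds x, DifferentiableAt ℝ f y := by
  filter_upwards [(hf.of_le (m := 1) (by norm_cast)).eventually (by simp)] with y hy
  exact hy.differentiableAt (by simp)

theorem fderiv_fderiv_comp {W : Type*} [NormedAddCommGroup W] [NormedSpace ℝ W] {f : P → W}
    {σ : Q → P} {s : Q} (hf : ContDiffAt ℝ ∞ f (σ s)) (hσ : ContDiffAt ℝ ∞ σ s) (a b : Q) :
    fderiv ℝ (fderiv ℝ (fun t => f (σ t))) s a b =
      fderiv ℝ (fderiv ℝ f) (σ s) (fderiv ℝ σ s a) (fderiv ℝ σ s b) +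
        fderiv ℝ f (σ s) (fderiv ℝ (fderiv ℝ σ) s a b) := by
  have h1 : fderiv ℝ (fun t => f (σ t)) =ᶠ[nhds s] fun t => fderiv ℝ f (σ t) ∘L fderiv ℝ σ t := by
    filter_upwards [eventually_differentiableAt hσ,
      hσ.continuousAt.eventually (eventually_differentiableAt hf)] with t h1 h2
    exact fderiv_comp t h2 h1
  have h2 : HasFDerivAt (fun t => fderiv ℝ f (σ t)) _ s :=
    HasFDerivAt.comp s (differentiableAt_fderiv hf).hasFDerivAt
      (hσ.differentiableAt (by simp)).hasFDerivAt
  have h3 := h2.clm_comp (differentiableAt_fderiv hσ).hasFDerivAt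
  rw [h1.fderiv_eq, h3.fderiv]
  simp
  abel

/-- The Hessian under a change of parameters `σ`. -/
theorem hess_comp_right {G : V → V →L[ℝ] V →L[ℝ] ℝ} {u : P → V} {σ : Q → P} {s : Q}
    (hu : ContDiffAt ℝ ∞ u (σ s)) (hσ : ContDiffAt ℝ ∞ σ s) (a b : Q) :
    hess G (fun t => u (σ t)) s a b = hess G u (σ s) (fderiv ℝ σ s a) (fderiv ℝ σ s b) +
      fderiv ℝ u (σ s) (fderiv ℝ (fderiv ℝ σ) s a b) := by
  have h1 : fderiv ℝ (fun t => u (σ t)) s = fderiv ℝ u (σ s) ∘L fderiv ℝ σ s :=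
    fderiv_comp s (hu.differentiableAt (by simp)) (hσ.differentiableAt (by simp))
  rw [hess, hess, fderiv_fderiv_comp hu hσ, h1]
  simp only [ContinuousLinearMap.comp_apply]
  abel

section isometry

variable {G₁ G₂ : V → V →L[ℝ] V →L[ℝ] ℝ} {Ω₁ Ω₂ : Set V} {τ : V → V} {y : V}

/-- The transformation law of the Christoffel symbols under an isometry `τ`. -/
theorem fderiv_christoffel_eq_hess (h₁ : IsMetricOn G₁ Ω₁) (h₂ : IsMetricOn G₂ Ω₂) (hy : y ∈ Ω₁)
    (hτy : τ y ∈ Ω₂) (hτ : ContDiffAt ℝ ∞ τ y)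
    (hiso : ∀ᶠ y in nhds y, ∀ v w, G₁ y v w = G₂ (τ y) (fderiv ℝ τ y v) (fderiv ℝ τ y w))
    (v w : V) : fderiv ℝ τ y (christoffel G₁ y v w) = hess G₂ τ y v w := by
  have hiso0 := hiso.self_of_nhds
  have hinj : Function.Injective (fderiv ℝ τ y) := by
    intro v w hvw
    refine h₁.eq_of_forall hy fun z => ?_
    rw [hiso0, hiso0, hvw]
  have hsurj : Function.Surjective (fderiv ℝ τ y) :=
    LinearMap.injective_iff_surjective (f := (fderiv ℝ τ y : V →ₗ[ℝ] V)).1 hinj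
  have hd : ∀ v, DifferentiableAt ℝ (fun y => fderiv ℝ τ y v) y := fun v =>
    ((differentiableAt_fderiv hτ).hasFDerivAt.clm_apply (hasFDerivAt_const v y)).differentiableAt
  have hder : ∀ z v w, fderiv ℝ G₁ y z v w =
      G₂ (τ y) (hess G₂ τ y z v) (fderiv ℝ τ y w) +
        G₂ (τ y) (fderiv ℝ τ y v) (hess G₂ τ y z w) := by
    intro z v w
    have h1 : fderiv ℝ G₁ y z v w = fderiv ℝ (fun y => G₁ y v w) y z := by
      have h2 := ((h₁.differentiableAt hy).hasFDerivAt.clm_apply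
        (hasFDerivAt_const v y)).clm_apply (hasFDerivAt_const w y)
      rw [h2.fderiv]
      simp
    have h2 : (fun y => G₁ y v w) =ᶠ[nhds y]
        fun y => G₂ (τ y) (fderiv ℝ τ y v) (fderiv ℝ τ y w) := hiso.mono fun x hx => hx v w
    rw [h1, h2.fderiv_eq, fderiv_metric h₂ hτy (hτ.differentiableAt (by simp)) (hd v) (hd w),
      covDeriv_fderiv hτ, covDeriv_fderiv hτ]
  refine h₂.eq_of_forall hτy fun z' => ?_
  obtain ⟨z, rfl⟩ := hsurj z'
  rw [← hiso0, h₁.apply_christoffel hy, hder, hder, hder, hess_comm h₂ hτy hτ w v,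
    hess_comm h₂ hτy hτ z v, hess_comm h₂ hτy hτ z w,
    h₂.symm _ hτy (fderiv ℝ τ y w) (hess G₂ τ y v z),
    h₂.symm _ hτy (fderiv ℝ τ y v) (hess G₂ τ y w z)]
  ring

/-- The Hessian is natural with respect to isometries `τ` of the target. -/
theorem hess_comp_left (h₁ : IsMetricOn G₁ Ω₁) (h₂ : IsMetricOn G₂ Ω₂) {u : P → V} {x : P}
    (hx : u x ∈ Ω₁) (hτx : τ (u x) ∈ Ω₂) (hu : ContDiffAt ℝ ∞ u x) (hτ : ContDiffAt ℝ ∞ τ (u x))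
    (hiso : ∀ᶠ y in nhds (u x),
      ∀ v w, G₁ y v w = G₂ (τ y) (fderiv ℝ τ y v) (fderiv ℝ τ y w))
    (a b : P) : hess G₂ (fun x => τ (u x)) x a b = fderiv ℝ τ (u x) (hess G₁ u x a b) := by
  have h1 : fderiv ℝ (fun x => τ (u x)) x = fderiv ℝ τ (u x) ∘L fderiv ℝ u x :=
    fderiv_comp x (hτ.differentiableAt (by simp)) (hu.differentiableAt (by simp))
  rw [hess, hess, fderiv_fderiv_comp hτ hu, h1, map_add,
    fderiv_christoffel_eq_hess h₁ h₂ hx hτx hτ hiso, hess]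
  simp only [ContinuousLinearMap.comp_apply]
  abel

end isometry

/-- A surface in a flat Riemannian `3`-space, given in an isothermal parametrization `u` with
conformal factor `lam` with respect to the vectors `e₁, e₂`, with a unit normal field `ν`.
`Ω` is the domain of the metric `G` and `U` that of the parametrization. -/
structure IsothermalSurface (G : V → V →L[ℝ] V →L[ℝ] ℝ) (Ω : Set V) (u ν : P → V) (lam : P → ℝ)
    (U : Set P) (e₁ e₂ : P) : Prop where
  metric : IsMetricOn G Ω
  flat : ∀ y ∈ Ω, ∀ a b c, curvature G y a b c = 0
  isOpen : IsOpen U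
  mapsTo : ∀ x ∈ U, u x ∈ Ω
  smooth : ∀ x ∈ U, ContDiffAt ℝ ∞ u x
  smooth_normal : ∀ x ∈ U, ContDiffAt ℝ ∞ ν x
  lam_pos : ∀ x ∈ U, 0 < lam x
  g11 : ∀ x ∈ U, G (u x) (fderiv ℝ u x e₁) (fderiv ℝ u x e₁) = lam x
  g22 : ∀ x ∈ U, G (u x) (fderiv ℝ u x e₂) (fderiv ℝ u x e₂) = lam x
  g12 : ∀ x ∈ U, G (u x) (fderiv ℝ u x e₁) (fderiv ℝ u x e₂) = 0
  normal₁ : ∀ x ∈ U, G (u x) (fderiv ℝ u x e₁) (ν x) = 0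
  normal₂ : ∀ x ∈ U, G (u x) (fderiv ℝ u x e₂) (ν x) = 0
  normal_unit : ∀ x ∈ U, G (u x) (ν x) (ν x) = 1

/-- The expansion of a bilinear form in an orthogonal basis of a `3`-dimensional space. -/
theorem apply_eq_of_orthogonal (hdim : Module.finrank ℝ V = 3) (B : V →L[ℝ] V →L[ℝ] ℝ)
    (hsymm : ∀ v w, B v w = B w v) {f₁ f₂ n : V} {c : ℝ} (hc : 0 < c)
    (h11 : B f₁ f₁ = c) (h22 : B f₂ f₂ = c) (hnn : B n n = 1)
    (h12 : B f₁ f₂ = 0) (h1n : B f₁ n = 0) (h2n : B f₂ n = 0) (X Y : V) :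
    B X Y = B X f₁ * B Y f₁ / c + B X f₂ * B Y f₂ / c + B X n * B Y n := by
  have h21 : B f₂ f₁ = 0 := by rw [hsymm, h12]
  have hn1 : B n f₁ = 0 := by rw [hsymm, h1n]
  have hn2 : B n f₂ = 0 := by rw [hsymm, h2n]
  have hli : LinearIndependent ℝ ![f₁, f₂, n] := by
    rw [Fintype.linearIndependent_iff]
    intro g hg
    simp only [Fin.sum_univ_three, Matrix.cons_val_zero, Matrix.cons_val_one,
      Matrix.cons_val] at hg
    have e1 := congrArg (fun v => B v f₁) hg
    have e2 := congrArg (fun v => B v f₂) hg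
    have e3 := congrArg (fun v => B v n) hg
    simp only [map_add, map_smul, add_apply, smul_apply, h11, h22, hnn, h12, h1n, h2n, h21, hn1,
      hn2, smul_eq_mul, mul_zero, add_zero, zero_add, map_zero, zero_apply, mul_one] at e1 e2 e3
    intro i
    fin_cases i
    · simpa [hc.ne'] using e1
    · simpa [hc.ne'] using e2
    · simpa using e3
  have hspan := hli.span_eq_top_of_card_eq_finrank (by simp [hdim])
  have hX : ∀ X : V, ∃ a b d : ℝ, X = a • f₁ + b • f₂ + d • n := by
    intro X
    have : X ∈ Submodule.span ℝ (Set.range ![f₁, f₂, n]) := by rw [hspan]; trivial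
    obtain ⟨g, hg⟩ := (Submodule.mem_span_range_iff_exists_fun ℝ).1 this
    refine ⟨g 0, g 1, g 2, ?_⟩
    rw [← hg]
    simp [Fin.sum_univ_three]
  obtain ⟨a, b, d, rfl⟩ := hX X
  obtain ⟨a', b', d', rfl⟩ := hX Y
  simp only [map_add, map_smul, add_apply, smul_apply, h11, h22, hnn, h12, h1n, h2n, h21, hn1,
    hn2, smul_eq_mul]
  field_simp
  ring

namespace IsothermalSurface

variable {G : V → V →L[ℝ] V →L[ℝ] ℝ} {Ω : Set V} {u ν : P → V} {lam : P → ℝ}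
    {U : Set P} {e₁ e₂ : P} {x : P}

/-- The second fundamental form with respect to the normal field `ν`. -/
def sff (G : V → V →L[ℝ] V →L[ℝ] ℝ) (u ν : P → V) (a b : P) (x : P) : ℝ :=
  G (u x) (hess G u x a b) (ν x)

variable (S : IsothermalSurface G Ω u ν lam U e₁ e₂)

include S

theorem smooth_fderiv (hx : x ∈ U) (a : P) : ContDiffAt ℝ ∞ (fun x => fderiv ℝ u x a) x :=
  contDiffAt_fderiv_apply (S.smooth x hx) contDiffAt_id contDiffAt_const

theorem hess_eventuallyEq (hx : x ∈ U) (a b : P) :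
    (fun x => hess G u x a b) =ᶠ[nhds x] covDeriv G u a (fun x => fderiv ℝ u x b) := by
  filter_upwards [S.isOpen.mem_nhds hx] with y hy
  exact (covDeriv_fderiv (S.smooth y hy) a b).symm

theorem smooth_hess (hx : x ∈ U) (a b : P) : ContDiffAt ℝ ∞ (fun x => hess G u x a b) x :=
  (contDiffAt_covDeriv S.metric (S.mapsTo x hx) (S.smooth x hx) (S.smooth_fderiv hx b)
    a).congr_of_eventuallyEq (S.hess_eventuallyEq hx a b)

theorem smooth_apply (hx : x ∈ U) {X Y : P → V} (hX : ContDiffAt ℝ ∞ X x)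
    (hY : ContDiffAt ℝ ∞ Y x) : ContDiffAt ℝ ∞ (fun x => G (u x) (X x) (Y x)) x :=
  (ContDiffAt.clm_apply (ContDiffAt.comp (g := G) (f := u) x
    (S.metric.contDiffAt (S.mapsTo x hx)) (S.smooth x hx)) hX).clm_apply hY

theorem smooth_sff (hx : x ∈ U) (a b : P) : ContDiffAt ℝ ∞ (sff G u ν a b) x :=
  S.smooth_apply hx (S.smooth_hess hx a b) (S.smooth_normal x hx)

theorem fderiv_apply (hx : x ∈ U) {X Y : P → V} (hX : ContDiffAt ℝ ∞ X x)
    (hY : ContDiffAt ℝ ∞ Y x) (a : P) : fderiv ℝ (fun x => G (u x) (X x) (Y x)) x a =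
      G (u x) (covDeriv G u a X x) (Y x) + G (u x) (X x) (covDeriv G u a Y x) :=
  fderiv_metric S.metric (S.mapsTo x hx) ((S.smooth x hx).differentiableAt (by simp))
    (hX.differentiableAt (by simp)) (hY.differentiableAt (by simp)) a

theorem fderiv_apply_fderiv (hx : x ∈ U) (a b c : P) :
    fderiv ℝ (fun x => G (u x) (fderiv ℝ u x b) (fderiv ℝ u x c)) x a =
      G (u x) (hess G u x a b) (fderiv ℝ u x c) + G (u x) (fderiv ℝ u x b) (hess G u x a c) := by
  rw [S.fderiv_apply hx (S.smooth_fderiv hx b) (S.smooth_fderiv hx c),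
    covDeriv_fderiv (S.smooth x hx), covDeriv_fderiv (S.smooth x hx)]

/-- The third covariant derivatives of `u` are symmetric, since the curvature vanishes. -/
theorem covDeriv_hess_comm (hx : x ∈ U) (a b c : P) :
    covDeriv G u a (fun x => hess G u x b c) x = covDeriv G u b (fun x => hess G u x a c) x := by
  have key : ∀ a b, covDeriv G u a (fun x => hess G u x b c) x =
      covDeriv G u a (covDeriv G u b (fun x => fderiv ℝ u x c)) x := by
    intro a b
    rw [covDeriv, covDeriv, (S.hess_eventuallyEq hx b c).fderiv_eq,
      covDeriv_fderiv (S.smooth x hx)]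
  rw [key, key]
  exact covDeriv_comm S.metric (S.mapsTo x hx) (S.smooth x hx)
    (fun _ _ _ => S.flat _ (S.mapsTo x hx) _ _ _) (S.smooth_fderiv hx c) a b

theorem symm (hx : x ∈ U) (v w : V) : G (u x) v w = G (u x) w v :=
  S.metric.symm _ (S.mapsTo x hx) v w

theorem hess_comm' (hx : x ∈ U) (a b : P) : hess G u x a b = hess G u x b a :=
  hess_comm S.metric (S.mapsTo x hx) (S.smooth x hx) a b

theorem apply_eq (hdim : Module.finrank ℝ V = 3) (hx : x ∈ U) (X Y : V) :
    G (u x) X Y = G (u x) X (fderiv ℝ u x e₁) * G (u x) Y (fderiv ℝ u x e₁) / lam x +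
      G (u x) X (fderiv ℝ u x e₂) * G (u x) Y (fderiv ℝ u x e₂) / lam x +
      G (u x) X (ν x) * G (u x) Y (ν x) :=
  apply_eq_of_orthogonal hdim (G (u x)) (S.symm hx) (S.lam_pos x hx) (S.g11 x hx) (S.g22 x hx)
    (S.normal_unit x hx) (S.g12 x hx) (S.normal₁ x hx) (S.normal₂ x hx) X Y

theorem fderiv_eq_of_eqOn {f g : P → ℝ} (hx : x ∈ U) (h : ∀ x ∈ U, f x = g x) :
    fderiv ℝ f x = fderiv ℝ g x :=
  Filter.EventuallyEq.fderiv_eq (by filter_upwards [S.isOpen.mem_nhds hx] with y hy using h y hy)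

theorem smooth_lam (hx : x ∈ U) : ContDiffAt ℝ ∞ lam x :=
  (S.smooth_apply hx (S.smooth_fderiv hx e₁) (S.smooth_fderiv hx e₁)).congr_of_eventuallyEq
    (by filter_upwards [S.isOpen.mem_nhds hx] with y hy using (S.g11 y hy).symm)

/-- The tangential components of the second derivatives of `u`. -/
theorem hess_tangential (hx : x ∈ U) :
    G (u x) (hess G u x e₁ e₁) (fderiv ℝ u x e₁) = fderiv ℝ lam x e₁ / 2 ∧
    G (u x) (hess G u x e₁ e₁) (fderiv ℝ u x e₂) = - fderiv ℝ lam x e₂ / 2 ∧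
    G (u x) (hess G u x e₁ e₂) (fderiv ℝ u x e₁) = fderiv ℝ lam x e₂ / 2 ∧
    G (u x) (hess G u x e₁ e₂) (fderiv ℝ u x e₂) = fderiv ℝ lam x e₁ / 2 ∧
    G (u x) (hess G u x e₂ e₂) (fderiv ℝ u x e₁) = - fderiv ℝ lam x e₁ / 2 ∧
    G (u x) (hess G u x e₂ e₂) (fderiv ℝ u x e₂) = fderiv ℝ lam x e₂ / 2 := by
  have h11 := S.fderiv_eq_of_eqOn hx S.g11
  have h22 := S.fderiv_eq_of_eqOn hx S.g22
  have h12 := S.fderiv_eq_of_eqOn (g := fun _ => 0) hx S.g12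
  have a1 := S.fderiv_apply_fderiv hx e₁ e₁ e₁
  have a2 := S.fderiv_apply_fderiv hx e₂ e₁ e₁
  have a3 := S.fderiv_apply_fderiv hx e₁ e₂ e₂
  have a4 := S.fderiv_apply_fderiv hx e₂ e₂ e₂
  have a5 := S.fderiv_apply_fderiv hx e₁ e₁ e₂
  have a6 := S.fderiv_apply_fderiv hx e₂ e₁ e₂
  rw [h11] at a1 a2
  rw [h22] at a3 a4
  rw [h12] at a5 a6
  rw [S.hess_comm' hx e₂ e₁] at a2 a6
  simp only [S.symm hx (fderiv ℝ u x _) (hess G u x _ _), fderiv_fun_const, Pi.zero_apply,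
    zero_apply] at a1 a2 a3 a4 a5 a6
  refine ⟨?_, ?_, ?_, ?_, ?_, ?_⟩ <;> linarith

/-- The Weingarten equations. -/
theorem covDeriv_normal (hx : x ∈ U) (a : P) :
    G (u x) (fderiv ℝ u x e₁) (covDeriv G u a ν x) = - sff G u ν a e₁ x ∧
    G (u x) (fderiv ℝ u x e₂) (covDeriv G u a ν x) = - sff G u ν a e₂ x ∧
    G (u x) (ν x) (covDeriv G u a ν x) = 0 := by
  have h1 := S.fderiv_apply hx (S.smooth_fderiv hx e₁) (S.smooth_normal x hx) a
  have h2 := S.fderiv_apply hx (S.smooth_fderiv hx e₂) (S.smooth_normal x hx) a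
  have h3 := S.fderiv_apply hx (S.smooth_normal x hx) (S.smooth_normal x hx) a
  rw [S.fderiv_eq_of_eqOn (g := fun _ => 0) hx S.normal₁, covDeriv_fderiv (S.smooth x hx)] at h1
  rw [S.fderiv_eq_of_eqOn (g := fun _ => 0) hx S.normal₂, covDeriv_fderiv (S.smooth x hx)] at h2
  rw [S.fderiv_eq_of_eqOn (g := fun _ => 1) hx S.normal_unit,
    S.symm hx (covDeriv G u a ν x)] at h3
  simp only [fderiv_fun_const, Pi.zero_apply, zero_apply] at h1 h2 h3
  unfold sff
  refine ⟨?_, ?_, ?_⟩ <;> linarith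

/-- The Codazzi equation before the tangential components are inserted: the third derivatives of `u`
cancel. -/
theorem codazzi_third_derivatives (hx : x ∈ U) (a b c : P) :
    fderiv ℝ (sff G u ν b c) x a - fderiv ℝ (sff G u ν a c) x b =
      G (u x) (hess G u x b c) (covDeriv G u a ν x) -
        G (u x) (hess G u x a c) (covDeriv G u b ν x) := by
  have h1 := S.fderiv_apply hx (S.smooth_hess hx b c) (S.smooth_normal x hx) a
  have h2 := S.fderiv_apply hx (S.smooth_hess hx a c) (S.smooth_normal x hx) b
  rw [S.covDeriv_hess_comm hx b a] at h2
  change fderiv ℝ (sff G u ν b c) x a = _ at h1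
  change fderiv ℝ (sff G u ν a c) x b = _ at h2
  rw [h1, h2]
  ring

/-- The Gauss equation before the tangential components are inserted. -/
theorem gauss_third_derivatives (hx : x ∈ U) (a b c d : P) :
    fderiv ℝ (fun x => G (u x) (hess G u x b c) (fderiv ℝ u x d)) x a -
        fderiv ℝ (fun x => G (u x) (hess G u x a c) (fderiv ℝ u x d)) x b =
      G (u x) (hess G u x b c) (hess G u x a d) - G (u x) (hess G u x a c) (hess G u x b d) := by
  have h1 := S.fderiv_apply hx (S.smooth_hess hx b c) (S.smooth_fderiv hx d) a
  have h2 := S.fderiv_apply hx (S.smooth_hess hx a c) (S.smooth_fderiv hx d) b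
  rw [S.covDeriv_hess_comm hx b a, covDeriv_fderiv (S.smooth x hx)] at h2
  rw [covDeriv_fderiv (S.smooth x hx)] at h1
  rw [h1, h2]
  ring

theorem sff_comm (hx : x ∈ U) (a b : P) : sff G u ν a b x = sff G u ν b a x := by
  rw [sff, sff, S.hess_comm' hx]

/-- The first Codazzi equation in isothermal coordinates. -/
theorem codazzi₁ (hdim : Module.finrank ℝ V = 3) (hx : x ∈ U) :
    fderiv ℝ (sff G u ν e₁ e₁) x e₂ - fderiv ℝ (sff G u ν e₁ e₂) x e₁ =
      fderiv ℝ lam x e₂ * (sff G u ν e₁ e₁ x + sff G u ν e₂ e₂ x) / (2 * lam x) := by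
  have hc := S.codazzi_third_derivatives hx e₂ e₁ e₁
  obtain ⟨t1, t2, t3, t4, t5, t6⟩ := S.hess_tangential hx
  obtain ⟨w1, w2, w3⟩ := S.covDeriv_normal hx e₁
  obtain ⟨w4, w5, w6⟩ := S.covDeriv_normal hx e₂
  rw [S.fderiv_eq_of_eqOn hx fun x hx => S.sff_comm hx e₂ e₁] at hc
  rw [hc, S.apply_eq hdim hx _ (covDeriv G u e₂ ν x), S.apply_eq hdim hx _ (covDeriv G u e₁ ν x)]
  simp only [S.symm hx (covDeriv G u _ ν x), w1, w2, w3, w4, w5, w6, S.hess_comm' hx e₂ e₁,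
    t1, t2, t3, t4, S.sff_comm hx e₂ e₁]
  have := (S.lam_pos x hx).ne'
  field_simp
  ring

/-- The second Codazzi equation in isothermal coordinates. -/
theorem codazzi₂ (hdim : Module.finrank ℝ V = 3) (hx : x ∈ U) :
    fderiv ℝ (sff G u ν e₂ e₂) x e₁ - fderiv ℝ (sff G u ν e₁ e₂) x e₂ =
      fderiv ℝ lam x e₁ * (sff G u ν e₁ e₁ x + sff G u ν e₂ e₂ x) / (2 * lam x) := by
  have hc := S.codazzi_third_derivatives hx e₁ e₂ e₂
  obtain ⟨t1, t2, t3, t4, t5, t6⟩ := S.hess_tangential hx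
  obtain ⟨w1, w2, w3⟩ := S.covDeriv_normal hx e₁
  obtain ⟨w4, w5, w6⟩ := S.covDeriv_normal hx e₂
  rw [hc, S.apply_eq hdim hx _ (covDeriv G u e₂ ν x), S.apply_eq hdim hx _ (covDeriv G u e₁ ν x)]
  simp only [S.symm hx (covDeriv G u _ ν x), w1, w2, w3, w4, w5, w6,
    t3, t4, t5, t6, S.sff_comm hx e₂ e₁]
  have := (S.lam_pos x hx).ne'
  field_simp
  ring

/-- The Gauss equation: the determinant of the second fundamental form is `lam ^ 2` times the
Gaussian curvature `- Δ (log lam) / (2 * lam)`. -/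
theorem gauss (hdim : Module.finrank ℝ V = 3) (hx : x ∈ U) :
    sff G u ν e₁ e₁ x * sff G u ν e₂ e₂ x - sff G u ν e₁ e₂ x ^ 2 =
      - (fderiv ℝ (fun x => fderiv ℝ lam x e₁) x e₁ +
        fderiv ℝ (fun x => fderiv ℝ lam x e₂) x e₂) / 2 +
      (fderiv ℝ lam x e₁ ^ 2 + fderiv ℝ lam x e₂ ^ 2) / (2 * lam x) := by
  have hg := S.gauss_third_derivatives hx e₂ e₁ e₁ e₂
  obtain ⟨t1, t2, t3, t4, t5, t6⟩ := S.hess_tangential hx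
  have hd : ∀ a, DifferentiableAt ℝ (fun x => fderiv ℝ lam x a) x := fun a =>
    (contDiffAt_fderiv_apply (S.smooth_lam hx) contDiffAt_id contDiffAt_const).differentiableAt
      (by simp)
  have h1 : fderiv ℝ (fun x => G (u x) (hess G u x e₁ e₁) (fderiv ℝ u x e₂)) x e₂ =
      -(1 / 2) * fderiv ℝ (fun x => fderiv ℝ lam x e₂) x e₂ := by
    rw [S.fderiv_eq_of_eqOn (g := fun x => -(1 / 2) * fderiv ℝ lam x e₂) hx fun x hx => by
      rw [(S.hess_tangential hx).2.1]; ring, fderiv_const_mul (hd _)]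
    rfl
  have h2 : fderiv ℝ (fun x => G (u x) (hess G u x e₂ e₁) (fderiv ℝ u x e₂)) x e₁ =
      (1 / 2) * fderiv ℝ (fun x => fderiv ℝ lam x e₁) x e₁ := by
    rw [S.fderiv_eq_of_eqOn (g := fun x => (1 / 2) * fderiv ℝ lam x e₁) hx fun x hx => by
      rw [S.hess_comm' hx e₂ e₁, (S.hess_tangential hx).2.2.2.1]; ring, fderiv_const_mul (hd _)]
    rfl
  rw [h1, h2, S.hess_comm' hx e₂ e₁, S.apply_eq hdim hx (hess G u x e₁ e₁),
    S.apply_eq hdim hx (hess G u x e₁ e₂), t1, t2, t3, t4, t5, t6] at hg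
  change _ = _ + sff G u ν e₁ e₁ x * sff G u ν e₂ e₂ x -
    (_ + sff G u ν e₁ e₂ x * sff G u ν e₁ e₂ x) at hg
  have := (S.lam_pos x hx).ne'
  field_simp at hg ⊢
  linarith

end IsothermalSurface

end isothermal

/-! ### The maximum principle for the mean curvature -/

section maximum

variable {P : Type*} [NormedAddCommGroup P] [NormedSpace ℝ P]

/-- The Hessian is negative semidefinite at a local maximum. -/
theorem fderiv_fderiv_nonpos_of_isLocalMax {f : P → ℝ} {x : P} (hf : ContDiffAt ℝ ∞ f x)
    (hmax : IsLocalMax f x) (v : P) : fderiv ℝ (fderiv ℝ f) x v v ≤ 0 := by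
  by_contra! hpos
  have hline : ∀ t : ℝ, HasDerivAt (fun t : ℝ => x + t • v) v t := fun t => by
    simpa using ((hasDerivAt_id t).smul_const v).const_add x
  have hcont : Filter.Tendsto (fun t : ℝ => x + t • v) (nhds 0) (nhds x) := by
    simpa using (hline 0).continuousAt.tendsto
  have h1 : deriv (fun t : ℝ => f (x + t • v)) =ᶠ[nhds 0] fun t => fderiv ℝ f (x + t • v) v := by
    filter_upwards [hcont.eventually (eventually_differentiableAt hf)] with t ht
    exact (ht.hasFDerivAt.comp_hasDerivAt t (hline t)).deriv
  have h2 : HasDerivAt (fun t : ℝ => fderiv ℝ f (x + t • v)) (fderiv ℝ (fderiv ℝ f) x v) 0 := by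
    refine HasFDerivAt.comp_hasDerivAt (0 : ℝ) ?_ (hline 0)
    simpa using (differentiableAt_fderiv hf).hasFDerivAt
  have h3 : deriv (deriv (fun t : ℝ => f (x + t • v))) 0 = fderiv ℝ (fderiv ℝ f) x v v := by
    rw [h1.deriv_eq, (h2.clm_apply (hasDerivAt_const (0 : ℝ) v)).deriv]
    simp
  have hmax' : IsLocalMax (fun t : ℝ => f (x + t • v)) 0 := by
    filter_upwards [hcont.eventually hmax] with t ht
    simpa using ht
  have hmin := isLocalMin_of_deriv_deriv_pos (h3 ▸ hpos) hmax'.deriv_eq_zero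
    (by
      have : ContinuousAt f (x + (0 : ℝ) • v) := by simpa using hf.continuousAt
      exact ContinuousAt.comp (g := f) this (hline 0).continuousAt)
  -- a function with both a local minimum and a local maximum at `0` is constant near `0`
  have hconst : (fun t : ℝ => f (x + t • v)) =ᶠ[nhds 0] fun _ => f x := by
    filter_upwards [hmin, hmax'] with t h1 h2
    simpa using le_antisymm h2 h1
  rw [hconst.deriv.deriv_eq] at h3
  simp at h3
  exact hpos.ne h3

set_option maxHeartbeats 1000000 in
/-- The analytic core: the equations of Codazzi and Gauss for a surface of curvature `1` with mean
curvature `H`, traceless second fundamental form `(A, M; M, -A)` and conformal factor `lam`.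
At an interior maximum of `H` which is not an umbilic the equations imply
`(H - A) H₁₁ - 2 M H₁₂ + (H + A) H₂₂ = 2 (H ^ 2 - 1) > 0`, although the coefficient matrix is
positive definite and the Hessian of `H` is negative semidefinite. -/
theorem umbilic_of_isLocalMax {lam H A M : P → ℝ} {x e₁ e₂ : P}
    (hlam : ContDiffAt ℝ ∞ lam x) (hH : ContDiffAt ℝ ∞ H x) (hA : ContDiffAt ℝ ∞ A x)
    (hM : ContDiffAt ℝ ∞ M x)
    (hc₁ : ∀ᶠ y in nhds x, fderiv ℝ A y e₁ + fderiv ℝ M y e₂ = lam y * fderiv ℝ H y e₁)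
    (hc₂ : ∀ᶠ y in nhds x, fderiv ℝ M y e₁ - fderiv ℝ A y e₂ = lam y * fderiv ℝ H y e₂)
    (hg : ∀ᶠ y in nhds x, A y ^ 2 + M y ^ 2 = lam y ^ 2 * (H y ^ 2 - 1))
    (hl : lam x = 1) (hl₁ : fderiv ℝ lam x e₁ = 0) (hl₂ : fderiv ℝ lam x e₂ = 0)
    (hl₁₁ : fderiv ℝ (fderiv ℝ lam) x e₁ e₁ = -1) (hl₂₂ : fderiv ℝ (fderiv ℝ lam) x e₂ e₂ = -1)
    (hHpos : 0 < H x) (hmax : IsLocalMax H x) : A x = 0 ∧ M x = 0 := by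
  have hg0 := hg.self_of_nhds
  rw [hl] at hg0
  by_contra hne
  have hpos : 0 < A x ^ 2 + M x ^ 2 := by
    rcases not_and_or.1 hne with h | h <;> positivity
  have hdH : fderiv ℝ H x = 0 := hmax.fderiv_eq_zero
  -- derivatives of products of the functions involved
  have hd : ∀ {f : P → ℝ}, ContDiffAt ℝ ∞ f x → ∀ a, HasFDerivAt (fun y => fderiv ℝ f y a)
      ((fderiv ℝ (fderiv ℝ f) x).flip a) x := by
    intro f hf a
    simpa using (differentiableAt_fderiv hf).hasFDerivAt.clm_apply (hasFDerivAt_const a x)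
  have hd0 : ∀ {f : P → ℝ}, ContDiffAt ℝ ∞ f x → HasFDerivAt f (fderiv ℝ f x) x :=
    fun hf => (hf.differentiableAt (by simp)).hasFDerivAt
  have hsymm : ∀ {f : P → ℝ}, ContDiffAt ℝ ∞ f x →
      fderiv ℝ (fderiv ℝ f) x e₁ e₂ = fderiv ℝ (fderiv ℝ f) x e₂ e₁ :=
    fun hf => (hf.isSymmSndFDerivAt (by simpa using ENat.LEInfty.out)).eq e₁ e₂
  -- the first derivative of the Gauss equation, near `x`
  have hg1 : ∀ a, ∀ᶠ y in nhds x, A y * fderiv ℝ A y a + M y * fderiv ℝ M y a =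
      lam y * fderiv ℝ lam y a * (H y ^ 2 - 1) + lam y ^ 2 * (H y * fderiv ℝ H y a) := by
    intro a
    filter_upwards [hg.eventually_nhds, eventually_differentiableAt hA,
      eventually_differentiableAt hM, eventually_differentiableAt hH,
      eventually_differentiableAt hlam] with y hy hA hM hH hlam
    have h1 := (hA.hasFDerivAt.mul hA.hasFDerivAt).add (hM.hasFDerivAt.mul hM.hasFDerivAt)
    have h2 := (hlam.hasFDerivAt.mul hlam.hasFDerivAt).mul
      ((hH.hasFDerivAt.mul hH.hasFDerivAt).sub_const 1)
    have h3 := h1.unique (h2.congr_of_eventuallyEq (by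
      filter_upwards [hy] with z hz
      simp only [Pi.mul_apply, Pi.add_apply]
      linarith))
    have h4 := congrArg (fun φ : P →L[ℝ] ℝ => φ a) h3
    simp at h4
    linarith
  -- hence the first derivatives of `A` and `M` vanish at `x`
  have c1 := hc₁.self_of_nhds
  have c2 := hc₂.self_of_nhds
  have g1 := (hg1 e₁).self_of_nhds
  have g2 := (hg1 e₂).self_of_nhds
  simp only [hl, hl₁, hl₂, hdH, zero_apply, mul_zero, zero_mul, add_zero] at c1 c2 g1 g2
  have hM2 : fderiv ℝ M x e₂ = - fderiv ℝ A x e₁ := by linarith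
  have hM1 : fderiv ℝ M x e₁ = fderiv ℝ A x e₂ := by linarith
  rw [hM1] at g1
  rw [hM2] at g2
  have hA1 : fderiv ℝ A x e₁ = 0 := by
    have : (A x ^ 2 + M x ^ 2) * fderiv ℝ A x e₁ = 0 := by linear_combination A x * g1 - M x * g2
    exact (mul_eq_zero.1 this).resolve_left hpos.ne'
  have hA2 : fderiv ℝ A x e₂ = 0 := by
    have : (A x ^ 2 + M x ^ 2) * fderiv ℝ A x e₂ = 0 := by linear_combination M x * g1 + A x * g2
    exact (mul_eq_zero.1 this).resolve_left hpos.ne'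
  rw [hA1, neg_zero] at hM2
  rw [hA2] at hM1
  -- second derivatives of the Gauss equation at `x`
  have hg2 : ∀ a, fderiv ℝ A x a = 0 → fderiv ℝ M x a = 0 → fderiv ℝ lam x a = 0 →
      A x * fderiv ℝ (fderiv ℝ A) x a a + M x * fderiv ℝ (fderiv ℝ M) x a a =
        fderiv ℝ (fderiv ℝ lam) x a a * (H x ^ 2 - 1) + H x * fderiv ℝ (fderiv ℝ H) x a a := by
    intro a ha1 ha2 ha3
    have h1 := ((hd0 hA).mul (hd hA a)).add ((hd0 hM).mul (hd hM a))
    have h2 := (((hd0 hlam).mul (hd hlam a)).mul (((hd0 hH).mul (hd0 hH)).sub_const 1)).add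
      (((hd0 hlam).mul (hd0 hlam)).mul ((hd0 hH).mul (hd hH a)))
    have h3 := h1.unique (h2.congr_of_eventuallyEq (by
      filter_upwards [hg1 a] with z hz
      simp only [Pi.mul_apply, Pi.add_apply]
      linarith))
    have h4 := congrArg (fun φ : P →L[ℝ] ℝ => φ a) h3
    simp [ha1, ha2, ha3, hl, hdH] at h4
    linarith
  have k1 := hg2 e₁ hA1 hM1 hl₁
  have k2 := hg2 e₂ hA2 hM2 hl₂
  -- first derivatives of the Codazzi equations at `x`
  have hC1 : ∀ a, fderiv ℝ (fderiv ℝ A) x a e₁ + fderiv ℝ (fderiv ℝ M) x a e₂ =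
      fderiv ℝ (fderiv ℝ H) x a e₁ := by
    intro a
    have h3 := ((hd hA e₁).add (hd hM e₂)).unique
      (((hd0 hlam).mul (hd hH e₁)).congr_of_eventuallyEq hc₁)
    have h4 := congrArg (fun φ : P →L[ℝ] ℝ => φ a) h3
    simpa [hl, hdH] using h4
  have hC2 : ∀ a, fderiv ℝ (fderiv ℝ M) x a e₁ - fderiv ℝ (fderiv ℝ A) x a e₂ =
      fderiv ℝ (fderiv ℝ H) x a e₂ := by
    intro a
    have h3 := ((hd hM e₁).sub (hd hA e₂)).unique
      (((hd0 hlam).mul (hd hH e₂)).congr_of_eventuallyEq hc₂)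
    have h4 := congrArg (fun φ : P →L[ℝ] ℝ => φ a) h3
    simpa [hl, hdH] using h4
  have m1 := hC1 e₁
  have m2 := hC1 e₂
  have m3 := hC2 e₁
  have m4 := hC2 e₂
  have sA := hsymm hA
  have sM := hsymm hM
  have sH := hsymm hH
  rw [hl₁₁] at k1
  rw [hl₂₂] at k2
  set a := A x
  set m := M x
  set h := H x
  -- the Codazzi equations and the symmetry of second derivatives turn `A * Δ A + M * Δ M` into
  -- a combination of second derivatives of `H`
  have key : (h - a) * fderiv ℝ (fderiv ℝ H) x e₁ e₁ - 2 * m * fderiv ℝ (fderiv ℝ H) x e₁ e₂ +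
      (h + a) * fderiv ℝ (fderiv ℝ H) x e₂ e₂ = 2 * (h ^ 2 - 1) := by
    linear_combination -k1 - k2 + a * (m1 - m4) + m * (m2 + m3) + (-a) * sM + m * sA - m * sH
  -- `(h - a)` times the form `key` is the Hessian at `(h - a, -m)` plus, by `hg0`, the one at `e₂`
  have hneg := fderiv_fderiv_nonpos_of_isLocalMax hH hmax ((h - a) • e₁ - m • e₂)
  have hneg2 := fderiv_fderiv_nonpos_of_isLocalMax hH hmax e₂
  simp only [map_sub, map_smul, sub_apply, smul_apply, smul_eq_mul] at hneg
  have hha : 0 < h - a := by nlinarith [sq_nonneg m]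
  have hpos2 : 0 < (h - a) * (2 * (h ^ 2 - 1)) := mul_pos hha (by linarith)
  have hsum : (h - a) * (2 * (h ^ 2 - 1)) =
      (h - a) * ((h - a) * fderiv ℝ (fderiv ℝ H) x e₁ e₁ - m * fderiv ℝ (fderiv ℝ H) x e₂ e₁) -
        m * ((h - a) * fderiv ℝ (fderiv ℝ H) x e₁ e₂ - m * fderiv ℝ (fderiv ℝ H) x e₂ e₂) +
      fderiv ℝ (fderiv ℝ H) x e₂ e₂ := by
    rw [← sH]
    linear_combination -(h - a) * key - fderiv ℝ (fderiv ℝ H) x e₂ e₂ * hg0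
  linarith

end maximum

/-! ### The round metric in stereographic coordinates -/

/-- The conformal factor of the round metric in a stereographic chart. Mathlib projects the sphere
to the plane through the origin and scales by `2`, so that the factor is `1` at the origin. -/
def roundFactor (x : EuclideanSpace ℝ (Fin 2)) : ℝ := 16 / (‖x‖ ^ 2 + 4) ^ 2

theorem roundFactor_pos (x : EuclideanSpace ℝ (Fin 2)) : 0 < roundFactor x := by
  unfold roundFactor
  positivity

theorem roundFactor_zero : roundFactor 0 = 1 := by norm_num [roundFactor]

theorem hasFDerivAt_norm_sq_add (x : EuclideanSpace ℝ (Fin 2)) :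
    HasFDerivAt (fun x : EuclideanSpace ℝ (Fin 2) => ‖x‖ ^ 2 + 4) (2 • innerSL ℝ x) x :=
  (hasStrictFDerivAt_norm_sq x).hasFDerivAt.add_const 4

theorem hasDerivAt_inv_pow (n : ℕ) {s : ℝ} (hs : s ≠ 0) :
    HasDerivAt (fun s : ℝ => (s ^ n)⁻¹) (-(n * s ^ (n - 1)) / (s ^ n) ^ 2) s :=
  (hasDerivAt_pow n s).fun_inv (pow_ne_zero n hs)

theorem fderiv_roundFactor (x a : EuclideanSpace ℝ (Fin 2)) :
    fderiv ℝ roundFactor x a = -64 * inner ℝ x a / (‖x‖ ^ 2 + 4) ^ 3 := by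
  have hr : ‖x‖ ^ 2 + 4 ≠ 0 := by positivity
  have h1 := (HasDerivAt.comp_hasFDerivAt (h₂ := fun s : ℝ => 16 * (s ^ 2)⁻¹) x
    ((hasDerivAt_inv_pow 2 hr).const_mul 16) (hasFDerivAt_norm_sq_add x))
  have h2 : fderiv ℝ roundFactor x = _ := h1.fderiv
  rw [h2]
  simp
  field_simp
  ring

theorem fderiv_fderiv_roundFactor (x a : EuclideanSpace ℝ (Fin 2)) :
    fderiv ℝ (fun x => fderiv ℝ roundFactor x a) x a =
      -64 * inner ℝ a a / (‖x‖ ^ 2 + 4) ^ 3 + 384 * (inner ℝ x a) ^ 2 / (‖x‖ ^ 2 + 4) ^ 4 := by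
  have hr : ‖x‖ ^ 2 + 4 ≠ 0 := by positivity
  simp only [fderiv_roundFactor]
  have h0 : HasFDerivAt (fun x : EuclideanSpace ℝ (Fin 2) => inner ℝ x a)
      (innerSL ℝ a) x := by
    simpa [real_inner_comm] using (innerSL ℝ a).hasFDerivAt (x := x)
  have h1 := ((h0.const_mul (-64)).mul (HasDerivAt.comp_hasFDerivAt
    (h₂ := fun s : ℝ => (s ^ 3)⁻¹) x (hasDerivAt_inv_pow 3 hr) (hasFDerivAt_norm_sq_add x)))
  have h2 : fderiv ℝ (fun x : EuclideanSpace ℝ (Fin 2) =>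
    -64 * inner ℝ x a / (‖x‖ ^ 2 + 4) ^ 3) x = _ := h1.fderiv
  rw [h2]
  simp
  field_simp
  ring

theorem contDiff_roundFactor : ContDiff ℝ ∞ roundFactor := by
  unfold roundFactor
  refine contDiff_const.div (((contDiff_norm_sq ℝ).add contDiff_const).pow 2) fun x => ?_
  positivity

/-- The inverse of the stereographic projection is conformal, with factor `roundFactor`. -/
theorem inner_fderiv_stereographic {E : Type*} [NormedAddCommGroup E] [InnerProductSpace ℝ E]
    (T : EuclideanSpace ℝ (Fin 2) →L[ℝ] E) (w : E)
    (hT : ∀ a b, inner ℝ (T a) (T b) = inner ℝ a b) (hTw : ∀ a, inner ℝ (T a) w = 0)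
    (hw : ‖w‖ = 1) (x a b : EuclideanSpace ℝ (Fin 2)) :
    let f : EuclideanSpace ℝ (Fin 2) → E := fun x =>
      (‖x‖ ^ 2 + 4)⁻¹ • (4 : ℝ) • T x + (‖x‖ ^ 2 + 4)⁻¹ • (‖x‖ ^ 2 - 4) • w
    inner ℝ (fderiv ℝ f x a) (fderiv ℝ f x b) = roundFactor x * inner ℝ a b := by
  intro f
  have hr : ‖x‖ ^ 2 + 4 ≠ 0 := by positivity
  have hN := hasFDerivAt_norm_sq_add x
  have hN2 : HasFDerivAt (fun x : EuclideanSpace ℝ (Fin 2) => ‖x‖ ^ 2 - 4) (2 • innerSL ℝ x) x :=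
    (hasStrictFDerivAt_norm_sq x).hasFDerivAt.sub_const 4
  have hI := HasDerivAt.comp_hasFDerivAt (h₂ := fun s : ℝ => s⁻¹) x (hasDerivAt_inv hr) hN
  have h1 := (hI.smul (T.hasFDerivAt.const_smul (4 : ℝ))).add (hI.smul (hN2.smul_const w))
  have h2 : fderiv ℝ f x = _ := h1.fderiv
  have key : ∀ a, fderiv ℝ f x a = (4 / (‖x‖ ^ 2 + 4)) • T a +
      (-8 * inner ℝ x a / (‖x‖ ^ 2 + 4) ^ 2) • T x +
      (16 * inner ℝ x a / (‖x‖ ^ 2 + 4) ^ 2) • w := by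
    intro a
    rw [h2]
    simp
    match_scalars <;> field_simp <;> ring
  rw [key, key]
  have hww : inner ℝ w w = (1 : ℝ) := by rw [real_inner_self_eq_norm_sq, hw]; norm_num
  have hwT : ∀ a, inner ℝ w (T a) = (0 : ℝ) := fun a => by rw [real_inner_comm, hTw]
  simp only [inner_add_left, inner_add_right, real_inner_smul_left, real_inner_smul_right, hT, hTw,
    hwT, hww, real_inner_self_eq_norm_sq, roundFactor, real_inner_comm x a]
  field_simp
  ring

/-! ### Metrics in the charts of a manifold -/

section charts

variable {n : ℕ} {M : Type*} [TopologicalSpace M] [ChartedSpace (EuclideanSpace ℝ (Fin n)) M]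
  [IsManifold (𝓡 n) ∞ M]

theorem isManifold_one : IsManifold (𝓡 n) 1 M := IsManifold.of_le (n := ∞) (by norm_cast)

theorem mfderiv_extChartAt_symm_comp {x₀ z : M} (hz : z ∈ (extChartAt (𝓡 n) x₀).source)
    (v : EuclideanSpace ℝ (Fin n)) :
    mfderiv 𝓘(ℝ, EuclideanSpace ℝ (Fin n)) (𝓡 n) (extChartAt (𝓡 n) x₀).symm
      (extChartAt (𝓡 n) x₀ z) (mfderiv (𝓡 n) 𝓘(ℝ, EuclideanSpace ℝ (Fin n))
        (extChartAt (𝓡 n) x₀) z v) = v := by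
  have := isManifold_one (n := n) (M := M)
  have h := mfderivWithin_extChartAt_symm_comp_mfderiv_extChartAt' (I := 𝓡 n) hz
  rw [modelWithCornersSelf_coe, Set.range_id, mfderivWithin_univ] at h
  exact congrArg (fun φ : EuclideanSpace ℝ (Fin n) →L[ℝ] EuclideanSpace ℝ (Fin n) => φ v) h

theorem mfderiv_extChartAt_comp_symm {x₀ : M} {y : EuclideanSpace ℝ (Fin n)}
    (hy : y ∈ (extChartAt (𝓡 n) x₀).target) (v : EuclideanSpace ℝ (Fin n)) :
    mfderiv (𝓡 n) 𝓘(ℝ, EuclideanSpace ℝ (Fin n)) (extChartAt (𝓡 n) x₀)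
      ((extChartAt (𝓡 n) x₀).symm y) (mfderiv 𝓘(ℝ, EuclideanSpace ℝ (Fin n)) (𝓡 n)
        (extChartAt (𝓡 n) x₀).symm y v) = v := by
  have := isManifold_one (n := n) (M := M)
  have h := mfderiv_extChartAt_comp_mfderivWithin_extChartAt_symm (I := 𝓡 n) hy
  rw [modelWithCornersSelf_coe, Set.range_id, mfderivWithin_univ] at h
  exact congrArg (fun φ : EuclideanSpace ℝ (Fin n) →L[ℝ] EuclideanSpace ℝ (Fin n) => φ v) h

/-- The tangent spaces of `M` are all identified with the model space here, so that the metrics at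
equal base points can be compared without transport. -/
theorem inner_congr_base (g : RiemMetric n M) {z z' : M} (h : z' = z)
    (v w : EuclideanSpace ℝ (Fin n)) :
    (g.inner z' : EuclideanSpace ℝ (Fin n) →L[ℝ] EuclideanSpace ℝ (Fin n) →L[ℝ] ℝ) v w =
      (g.inner z : EuclideanSpace ℝ (Fin n) →L[ℝ] EuclideanSpace ℝ (Fin n) →L[ℝ] ℝ) v w := by
  subst h
  rfl

/-- The differential of a chart is an isometry for the metric in the chart. -/
theorem chartMetric_mfderiv (g : RiemMetric n M) {x₀ z : M}
    (hz : z ∈ (extChartAt (𝓡 n) x₀).source) (v w : TangentSpace (𝓡 n) z) :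
    chartMetric g x₀ (extChartAt (𝓡 n) x₀ z)
      (mfderiv (𝓡 n) 𝓘(ℝ, EuclideanSpace ℝ (Fin n)) (extChartAt (𝓡 n) x₀) z v)
      (mfderiv (𝓡 n) 𝓘(ℝ, EuclideanSpace ℝ (Fin n)) (extChartAt (𝓡 n) x₀) z w) =
    g.inner z v w := by
  have h := inner_congr_base g ((extChartAt (𝓡 n) x₀).left_inv hz) v w
  rw [← h]
  have hv := mfderiv_extChartAt_symm_comp hz v
  have hw := mfderiv_extChartAt_symm_comp hz w
  change (g.inner ((extChartAt (𝓡 n) x₀).symm (extChartAt (𝓡 n) x₀ z)) :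
    EuclideanSpace ℝ (Fin n) →L[ℝ] EuclideanSpace ℝ (Fin n) →L[ℝ] ℝ)
    (mfderiv 𝓘(ℝ, EuclideanSpace ℝ (Fin n)) (𝓡 n) (extChartAt (𝓡 n) x₀).symm
      (extChartAt (𝓡 n) x₀ z) (mfderiv (𝓡 n) 𝓘(ℝ, EuclideanSpace ℝ (Fin n))
        (extChartAt (𝓡 n) x₀) z v))
    (mfderiv 𝓘(ℝ, EuclideanSpace ℝ (Fin n)) (𝓡 n) (extChartAt (𝓡 n) x₀).symm
      (extChartAt (𝓡 n) x₀ z) (mfderiv (𝓡 n) 𝓘(ℝ, EuclideanSpace ℝ (Fin n))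
        (extChartAt (𝓡 n) x₀) z w)) = _
  rw [hv, hw]

theorem contMDiffAt_extChartAt_symm {x₀ : M} {y : EuclideanSpace ℝ (Fin n)}
    (hy : y ∈ (extChartAt (𝓡 n) x₀).target) :
    ContMDiffAt 𝓘(ℝ, EuclideanSpace ℝ (Fin n)) (𝓡 n) ∞ (extChartAt (𝓡 n) x₀).symm y :=
  (contMDiffOn_extChartAt_symm x₀).contMDiffAt ((isOpen_extChartAt_target x₀).mem_nhds hy)

/-- The metric of a manifold, pulled back along a map `f`, can be computed in a chart. -/
theorem chartMetric_fderiv (g : RiemMetric n M) {x₀ : M} {P : Type*} [NormedAddCommGroup P]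
    [NormedSpace ℝ P] {f : P → M} {x : P} (hf : MDifferentiableAt 𝓘(ℝ, P) (𝓡 n) f x)
    (hx : f x ∈ (extChartAt (𝓡 n) x₀).source) (a b : P) :
    chartMetric g x₀ (extChartAt (𝓡 n) x₀ (f x))
      (fderiv ℝ (fun x => extChartAt (𝓡 n) x₀ (f x)) x a)
      (fderiv ℝ (fun x => extChartAt (𝓡 n) x₀ (f x)) x b) =
    g.inner (f x) (mfderiv 𝓘(ℝ, P) (𝓡 n) f x a) (mfderiv 𝓘(ℝ, P) (𝓡 n) f x b) := by
  have := isManifold_one (n := n) (M := M)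
  rw [← chartMetric_mfderiv g hx]
  have hφ : MDifferentiableAt (𝓡 n) 𝓘(ℝ, EuclideanSpace ℝ (Fin n)) (extChartAt (𝓡 n) x₀) (f x) :=
    mdifferentiableAt_extChartAt (by simpa using hx)
  have h := mfderiv_comp x hφ hf
  rw [mfderiv_eq_fderiv] at h
  have h' : ∀ a, fderiv ℝ (fun x => extChartAt (𝓡 n) x₀ (f x)) x a =
      mfderiv (𝓡 n) 𝓘(ℝ, EuclideanSpace ℝ (Fin n)) (extChartAt (𝓡 n) x₀) (f x)
        (mfderiv 𝓘(ℝ, P) (𝓡 n) f x a) := fun a =>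
    congrArg (fun φ : P →L[ℝ] EuclideanSpace ℝ (Fin n) => φ a) h
  rw [h', h']

theorem isMetricOn_chartMetric (g : RiemMetric n M) (x₀ : M) :
    IsMetricOn (chartMetric g x₀) (extChartAt (𝓡 n) x₀).target where
  isOpen := isOpen_extChartAt_target x₀
  symm y _ v w := g.symm _ _ _
  pos y hy v hv := by
    refine g.pos ((extChartAt (𝓡 n) x₀).symm y) (mfderiv 𝓘(ℝ, EuclideanSpace ℝ (Fin n)) (𝓡 n)
      (extChartAt (𝓡 n) x₀).symm y v) fun h0 => hv ?_
    refine (mfderiv_extChartAt_comp_symm hy v).symm.trans ?_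
    exact (congrArg _ h0).trans (map_zero (mfderiv (𝓡 n) 𝓘(ℝ, EuclideanSpace ℝ (Fin n))
      (extChartAt (𝓡 n) x₀) ((extChartAt (𝓡 n) x₀).symm y)))
  contDiffOn := by
    have := isManifold_one (n := n) (M := M)
    -- a constant vector in the chart is a smooth section of the tangent bundle over the chart
    have hsec : ∀ v : EuclideanSpace ℝ (Fin n), ∀ y ∈ (extChartAt (𝓡 n) x₀).target,
        ContMDiffAt 𝓘(ℝ, EuclideanSpace ℝ (Fin n)) (𝓡 n).tangent ∞
          (fun y => (⟨(extChartAt (𝓡 n) x₀).symm y,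
            mfderiv 𝓘(ℝ, EuclideanSpace ℝ (Fin n)) (𝓡 n) (extChartAt (𝓡 n) x₀).symm y v⟩ :
            TangentBundle (𝓡 n) M)) y := by
      intro v y hy
      have hopen := isOpen_extChartAt_target (I := 𝓡 n) x₀
      have h1 := (contMDiffOn_extChartAt_symm (I := 𝓡 n) (n := ∞)
        x₀).contMDiffOn_tangentMapWithin (m := ∞) (by simp) hopen.uniqueMDiffOn
      have h2 : ContMDiffAt 𝓘(ℝ, EuclideanSpace ℝ (Fin n)) 𝓘(ℝ, EuclideanSpace ℝ (Fin n)).tangent ∞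
          (fun y => (⟨y, v⟩ : TangentBundle 𝓘(ℝ, EuclideanSpace ℝ (Fin n))
            (EuclideanSpace ℝ (Fin n)))) y :=
        contMDiffAt_vectorSpace_iff_contDiffAt.2 contDiffAt_const
      have h3 := (h1 ⟨y, v⟩ hy).comp_of_eq (f := fun y => (⟨y, v⟩ :
        TangentBundle 𝓘(ℝ, EuclideanSpace ℝ (Fin n)) (EuclideanSpace ℝ (Fin n))))
        (x := y) (s := (extChartAt (𝓡 n) x₀).target) h2.contMDiffWithinAt (fun z hz => hz) rfl
      have h4 := h3.contMDiffAt (hopen.mem_nhds hy)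
      refine h4.congr_of_eventuallyEq ?_
      filter_upwards [hopen.mem_nhds hy] with z hz
      simp only [Function.comp, tangentMapWithin]
      rw [mfderivWithin_of_isOpen hopen hz]
    refine contDiffOn_clm_apply.2 fun v => contDiffOn_clm_apply.2 fun w y hy => ?_
    refine ContDiffAt.contDiffWithinAt (contMDiffAt_iff_contDiffAt.1 ?_)
    have hψ := ContMDiffAt.comp y (g.contMDiff ((extChartAt (𝓡 n) x₀).symm y))
      (contMDiffAt_extChartAt_symm hy)
    have h := ContMDiffAt.clm_bundle_apply₂ (F₃ := ℝ) (E₃ := fun _ : M => ℝ) hψ (hsec v y hy)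
      (hsec w y hy)
    exact (Bundle.contMDiffAt_totalSpace.1 h).2

/-- The transition maps of `M` are isometries between the metrics in the charts. -/
theorem chartMetric_transition (g : RiemMetric n M) {x₁ x₂ : M} {y : EuclideanSpace ℝ (Fin n)}
    (hy : y ∈ (extChartAt (𝓡 n) x₁).target)
    (hy' : (extChartAt (𝓡 n) x₁).symm y ∈ (extChartAt (𝓡 n) x₂).source)
    (v w : EuclideanSpace ℝ (Fin n)) :
    chartMetric g x₁ y v w =
      chartMetric g x₂ (extChartAt (𝓡 n) x₂ ((extChartAt (𝓡 n) x₁).symm y))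
        (fderiv ℝ (fun y => extChartAt (𝓡 n) x₂ ((extChartAt (𝓡 n) x₁).symm y)) y v)
        (fderiv ℝ (fun y => extChartAt (𝓡 n) x₂ ((extChartAt (𝓡 n) x₁).symm y)) y w) := by
  rw [chartMetric_fderiv g ((contMDiffAt_extChartAt_symm hy).mdifferentiableAt (by simp)) hy']
  rfl

theorem contDiffAt_extChartAt_comp {P : Type*} [NormedAddCommGroup P] [NormedSpace ℝ P]
    {x₀ : M} {f : P → M} {x : P} (hf : ContMDiffAt 𝓘(ℝ, P) (𝓡 n) ∞ f x)
    (hx : f x ∈ (extChartAt (𝓡 n) x₀).source) :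
    ContDiffAt ℝ ∞ (fun x => extChartAt (𝓡 n) x₀ (f x)) x :=
  contMDiffAt_iff_contDiffAt.1
    (ContMDiffAt.comp x (contMDiffAt_extChartAt' (by simpa using hx)) hf)

end charts

section sphere

theorem extChartAt_sphere_target (p : S2) : (extChartAt (𝓡 2) p).target = Set.univ := by
  have : Fact (Module.finrank ℝ (EuclideanSpace ℝ (Fin (2 + 1))) = 2 + 1) :=
    ⟨finrank_euclideanSpace_fin⟩
  rw [extChartAt_target]
  simp only [modelWithCornersSelf_coe_symm, Set.preimage_id_eq, id, modelWithCornersSelf_coe,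
    Set.range_id, Set.inter_univ]
  exact stereographic'_target _

theorem extChartAt_sphere_self (p : S2) : extChartAt (𝓡 2) p p = 0 := by
  have : Fact (Module.finrank ℝ (EuclideanSpace ℝ (Fin 3)) = 2 + 1) :=
    ⟨finrank_euclideanSpace_fin⟩
  exact (congrArg (OrthonormalBasis.fromOrthogonalSpanSingleton 2
    (ne_zero_of_mem_unit_sphere (-p))).repr (stereographic_neg_apply p)).trans (map_zero _)

/-- In the charts of the sphere, which are stereographic, the round metric is conformal to the
flat one. -/
theorem roundMetric_extChartAt_symm (p : S2) (x a b : EuclideanSpace ℝ (Fin 2)) :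
    roundMetric ((extChartAt (𝓡 2) p).symm x)
      (mfderiv 𝓘(ℝ, EuclideanSpace ℝ (Fin 2)) (𝓡 2) (extChartAt (𝓡 2) p).symm x a)
      (mfderiv 𝓘(ℝ, EuclideanSpace ℝ (Fin 2)) (𝓡 2) (extChartAt (𝓡 2) p).symm x b) =
    roundFactor x * inner ℝ a b := by
  have : Fact (Module.finrank ℝ (EuclideanSpace ℝ (Fin 3)) = 2 + 1) :=
    ⟨finrank_euclideanSpace_fin⟩
  have hx : x ∈ (extChartAt (𝓡 2) p).target := by
    rw [extChartAt_sphere_target]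
    trivial
  have hχ : MDifferentiableAt 𝓘(ℝ, EuclideanSpace ℝ (Fin 2)) (𝓡 2) (extChartAt (𝓡 2) p).symm x :=
    (contMDiffAt_extChartAt_symm hx).mdifferentiableAt (by simp)
  have hι : MDifferentiableAt (𝓡 2) 𝓘(ℝ, EuclideanSpace ℝ (Fin 3))
      (fun x : S2 => (x : EuclideanSpace ℝ (Fin 3))) ((extChartAt (𝓡 2) p).symm x) :=
    (contMDiff_coe_sphere (n := 2) (m := ∞) _).mdifferentiableAt (by simp)
  have hcomp := mfderiv_comp x hι hχ
  rw [mfderiv_eq_fderiv] at hcomp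
  have hcomp' : ∀ a, mfderiv (𝓡 2) 𝓘(ℝ, EuclideanSpace ℝ (Fin 3))
      (fun x : S2 => (x : EuclideanSpace ℝ (Fin 3))) ((extChartAt (𝓡 2) p).symm x)
      (mfderiv 𝓘(ℝ, EuclideanSpace ℝ (Fin 2)) (𝓡 2) (extChartAt (𝓡 2) p).symm x a) =
      fderiv ℝ (fun x => ((extChartAt (𝓡 2) p).symm x : EuclideanSpace ℝ (Fin 3))) x a := fun a =>
    (congrArg (fun φ : EuclideanSpace ℝ (Fin 2) →L[ℝ] EuclideanSpace ℝ (Fin 3) => φ a) hcomp).symm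
  refine (congrArg₂ (fun v w : EuclideanSpace ℝ (Fin 3) => (inner ℝ v w : ℝ)) (hcomp' a)
    (hcomp' b)).trans ?_
  -- the linear isometry of the plane onto the orthogonal complement of the projection centre `-p`
  let U : (ℝ ∙ ((-p : S2) : EuclideanSpace ℝ (Fin 3)))ᗮ ≃ₗᵢ[ℝ] EuclideanSpace ℝ (Fin 2) :=
    (OrthonormalBasis.fromOrthogonalSpanSingleton 2
      (ne_zero_of_mem_unit_sphere (-p))).repr
  let T : EuclideanSpace ℝ (Fin 2) →L[ℝ] EuclideanSpace ℝ (Fin 3) :=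
    (Submodule.subtypeL _) ∘L U.symm.toContinuousLinearEquiv.toContinuousLinearMap
  have hT : ∀ a b, inner ℝ (T a) (T b) = inner ℝ a b := fun a b => U.symm.inner_map_map a b
  have hTn : ∀ a, ‖T a‖ = ‖a‖ := fun a => U.symm.norm_map a
  have hTw : ∀ a, inner ℝ (T a) ((-p : S2) : EuclideanSpace ℝ (Fin 3)) = 0 := fun a =>
    Submodule.mem_orthogonal_singleton_iff_inner_left.1 (U.symm a).2
  have hf : (fun x => ((extChartAt (𝓡 2) p).symm x : EuclideanSpace ℝ (Fin 3))) = fun x =>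
      (‖x‖ ^ 2 + 4)⁻¹ • (4 : ℝ) • T x +
        (‖x‖ ^ 2 + 4)⁻¹ • (‖x‖ ^ 2 - 4) • ((-p : S2) : EuclideanSpace ℝ (Fin 3)) := by
    funext x
    have h := stereographic'_symm_apply (n := 2) (-p) x
    change _ = (‖T x‖ ^ 2 + 4)⁻¹ • (4 : ℝ) • T x + (‖T x‖ ^ 2 + 4)⁻¹ • (‖T x‖ ^ 2 - 4) •
      ((-p : S2) : EuclideanSpace ℝ (Fin 3)) at h
    rw [hTn] at h
    exact h
  rw [hf]
  exact inner_fderiv_stereographic T _ hT hTw (norm_eq_of_mem_sphere (-p)) x a b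

end sphere

/-! ### Pieces of the unit sphere in a flat space -/

section

variable {V : Type*} [NormedAddCommGroup V] [NormedSpace ℝ V] [FiniteDimensional ℝ V]
  {P : Type*} [NormedAddCommGroup P] [NormedSpace ℝ P]

/-- A surface in isothermal parametrization in a `3`-dimensional space has a smooth unit normal
field near each of its points. -/
theorem exists_isothermalSurface {G : V → V →L[ℝ] V →L[ℝ] ℝ} {Ω : Set V} {u : P → V} {lam : P → ℝ}
    {U₀ : Set P} {e₁ e₂ : P} (hdim : Module.finrank ℝ V = 3) (hG : IsMetricOn G Ω)
    (hflat : ∀ y ∈ Ω, ∀ a b c, curvature G y a b c = 0) (hU₀ : IsOpen U₀)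
    (hmaps : ∀ x ∈ U₀, u x ∈ Ω) (hu : ∀ x ∈ U₀, ContDiffAt ℝ ∞ u x)
    (hlam : ∀ x ∈ U₀, ContDiffAt ℝ ∞ lam x) (hpos : ∀ x ∈ U₀, 0 < lam x)
    (h11 : ∀ x ∈ U₀, G (u x) (fderiv ℝ u x e₁) (fderiv ℝ u x e₁) = lam x)
    (h22 : ∀ x ∈ U₀, G (u x) (fderiv ℝ u x e₂) (fderiv ℝ u x e₂) = lam x)
    (h12 : ∀ x ∈ U₀, G (u x) (fderiv ℝ u x e₁) (fderiv ℝ u x e₂) = 0) {x₀ : P} (hx₀ : x₀ ∈ U₀) :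
    ∃ (ν : P → V) (U : Set P), x₀ ∈ U ∧ U ⊆ U₀ ∧ IsothermalSurface G Ω u ν lam U e₁ e₂ := by
  obtain ⟨n₀, hn₀, hn₀ne⟩ : ∃ n₀ : V, (G (u x₀) (fderiv ℝ u x₀ e₁) n₀ = 0 ∧
      G (u x₀) (fderiv ℝ u x₀ e₂) n₀ = 0) ∧ n₀ ≠ 0 := by
    have hker := LinearMap.ker_ne_bot_of_finrank_lt
      (f := ((G (u x₀) (fderiv ℝ u x₀ e₁)).prod (G (u x₀) (fderiv ℝ u x₀ e₂)) : V →ₗ[ℝ] ℝ × ℝ))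
      (by simp [hdim])
    obtain ⟨n₀, hn, hne⟩ := Submodule.exists_mem_ne_zero_of_ne_bot hker
    exact ⟨n₀, by simpa using hn, hne⟩
  have hsymm : ∀ x ∈ U₀, ∀ v w, G (u x) v w = G (u x) w v := fun x hx => hG.symm _ (hmaps x hx)
  have hGs : ∀ x ∈ U₀, ∀ {X Y : P → V}, ContDiffAt ℝ ∞ X x → ContDiffAt ℝ ∞ Y x →
      ContDiffAt ℝ ∞ (fun x => G (u x) (X x) (Y x)) x := fun x hx X Y hX hY =>
    (ContDiffAt.clm_apply (ContDiffAt.comp (g := G) (f := u) x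
      (hG.contDiffAt (hmaps x hx)) (hu x hx)) hX).clm_apply hY
  have hfu : ∀ x ∈ U₀, ∀ a, ContDiffAt ℝ ∞ (fun x => fderiv ℝ u x a) x := fun x hx a =>
    contDiffAt_fderiv_apply (hu x hx) contDiffAt_id contDiffAt_const
  -- the projection of the constant vector `n₀` to the normal space
  let m : P → V := fun x => n₀ - (G (u x) (fderiv ℝ u x e₁) n₀ / lam x) • fderiv ℝ u x e₁ -
    (G (u x) (fderiv ℝ u x e₂) n₀ / lam x) • fderiv ℝ u x e₂
  have hm : ∀ x ∈ U₀, ContDiffAt ℝ ∞ m x := fun x hx =>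
    (contDiffAt_const.sub (((hGs x hx (hfu x hx e₁) contDiffAt_const).div (hlam x hx)
      (hpos x hx).ne').smul (hfu x hx e₁))).sub (((hGs x hx (hfu x hx e₂) contDiffAt_const).div
        (hlam x hx) (hpos x hx).ne').smul (hfu x hx e₂))
  have hm1 : ∀ x ∈ U₀, G (u x) (fderiv ℝ u x e₁) (m x) = 0 := by
    intro x hx
    have := (hpos x hx).ne'
    simp only [m, map_sub, map_smul, h11 x hx, h12 x hx, smul_eq_mul]
    field_simp
    ring
  have hm2 : ∀ x ∈ U₀, G (u x) (fderiv ℝ u x e₂) (m x) = 0 := by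
    intro x hx
    have := (hpos x hx).ne'
    simp only [m, map_sub, map_smul, h22 x hx, hsymm x hx (fderiv ℝ u x e₂) (fderiv ℝ u x e₁),
      h12 x hx, smul_eq_mul]
    field_simp
    ring
  have hm0 : m x₀ = n₀ := by simp [m, hn₀.1, hn₀.2]
  have hev : ∀ᶠ x in nhds x₀, m x ≠ 0 :=
    (hm x₀ hx₀).continuousAt.eventually_ne (by rw [hm0]; exact hn₀ne)
  obtain ⟨U, hU, hUo, hxU⟩ := mem_nhds_iff.1 (hev.and (hU₀.mem_nhds hx₀))
  have hUU : ∀ x ∈ U, x ∈ U₀ := fun x hx => (hU hx).2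
  have hq : ∀ x ∈ U, 0 < G (u x) (m x) (m x) := fun x hx =>
    hG.pos _ (hmaps x (hUU x hx)) _ (hU hx).1
  refine ⟨fun x => (√(G (u x) (m x) (m x)))⁻¹ • m x, U, hxU, hUU, hG, hflat, hUo,
    fun x hx => hmaps x (hUU x hx), fun x hx => hu x (hUU x hx), fun x hx => ?_,
    fun x hx => hpos x (hUU x hx), fun x hx => h11 x (hUU x hx), fun x hx => h22 x (hUU x hx),
    fun x hx => h12 x (hUU x hx), fun x hx => ?_, fun x hx => ?_, fun x hx => ?_⟩
  · have h1 := hm x (hUU x hx)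
    exact (((hGs x (hUU x hx) h1 h1).sqrt (hq x hx).ne').inv
      (Real.sqrt_pos.2 (hq x hx)).ne').smul h1
  · simp [hm1 x (hUU x hx)]
  · simp [hm2 x (hUU x hx)]
  · have h1 := Real.mul_self_sqrt (hq x hx).le
    have h2 := (Real.sqrt_pos.2 (hq x hx)).ne'
    simp only [map_smul, smul_apply, smul_eq_mul]
    field_simp
    linarith

theorem hess_congr {G : V → V →L[ℝ] V →L[ℝ] ℝ} {u u' : P → V} {x : P} (h : u =ᶠ[nhds x] u')
    (a b : P) : hess G u x a b = hess G u' x a b := by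
  rw [hess, hess, h.fderiv.fderiv_eq, h.fderiv_eq, h.self_of_nhds]

namespace IsothermalSurface

variable {G : V → V →L[ℝ] V →L[ℝ] ℝ} {Ω : Set V} {u ν : P → V} {lam : P → ℝ}
    {U : Set P} {e₁ e₂ : P} {x : P}

theorem sff_neg (a b : P) : sff G u (fun x => - ν x) a b = fun x => - sff G u ν a b x := by
  funext x
  simp [sff]

theorem neg_normal (S : IsothermalSurface G Ω u ν lam U e₁ e₂) :
    IsothermalSurface G Ω u (fun x => - ν x) lam U e₁ e₂ :=
  { S with
    smooth_normal := fun x hx => (S.smooth_normal x hx).neg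
    normal₁ := fun x hx => by simp [S.normal₁ x hx]
    normal₂ := fun x hx => by simp [S.normal₂ x hx]
    normal_unit := fun x hx => by simp [S.normal_unit x hx] }

theorem sff_combination (S : IsothermalSurface G Ω u ν lam U e₁ e₂) (hx : x ∈ U) (α β γ δ : ℝ) :
    sff G u ν (α • e₁ + β • e₂) (γ • e₁ + δ • e₂) x = α * γ * sff G u ν e₁ e₁ x +
      (α * δ + β * γ) * sff G u ν e₁ e₂ x + β * δ * sff G u ν e₂ e₂ x := by
  have h := S.sff_comm hx e₂ e₁
  simp only [sff, hess, map_add, map_smul, add_apply, smul_apply, christoffel_add_left,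
    christoffel_add_right, christoffel_smul_left, christoffel_smul_right, smul_eq_mul] at h ⊢
  linear_combination (β * γ) * h

end IsothermalSurface

end

/-- The standard basis of the plane. -/
abbrev stdVec (i : Fin 2) : EuclideanSpace ℝ (Fin 2) := EuclideanSpace.single i 1

theorem eq_stdVec (a : EuclideanSpace ℝ (Fin 2)) : a = a 0 • stdVec 0 + a 1 • stdVec 1 := by
  ext i
  fin_cases i <;> simp

theorem inner_plane (a b : EuclideanSpace ℝ (Fin 2)) :
    inner ℝ a b = a 0 * b 0 + a 1 * b 1 := by
  simp [PiLp.inner_apply, Fin.sum_univ_two, mul_comm]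

section round

open IsothermalSurface

variable {V : Type*} [NormedAddCommGroup V] [NormedSpace ℝ V] [FiniteDimensional ℝ V]
  {G : V → V →L[ℝ] V →L[ℝ] ℝ} {Ω : Set V} {u ν : EuclideanSpace ℝ (Fin 2) → V}
  {U : Set (EuclideanSpace ℝ (Fin 2))} {x : EuclideanSpace ℝ (Fin 2)}

/-- The Gauss equation for an isometric immersion of a piece of the unit sphere. -/
theorem IsothermalSurface.gauss_round
    (S : IsothermalSurface G Ω u ν roundFactor U (stdVec 0) (stdVec 1))
    (hdim : Module.finrank ℝ V = 3) (hx : x ∈ U) :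
    sff G u ν (stdVec 0) (stdVec 0) x * sff G u ν (stdVec 1) (stdVec 1) x -
      sff G u ν (stdVec 0) (stdVec 1) x ^ 2 = roundFactor x ^ 2 := by
  rw [S.gauss hdim hx, fderiv_fderiv_roundFactor, fderiv_fderiv_roundFactor, fderiv_roundFactor,
    fderiv_roundFactor, roundFactor]
  have hn : ‖x‖ ^ 2 = x 0 ^ 2 + x 1 ^ 2 := by
    rw [← real_inner_self_eq_norm_sq, inner_plane]
    ring
  simp only [inner_plane, hn]
  simp
  field_simp
  ring

/-- At a local maximum of the mean curvature, a piece of the unit sphere immersed isometrically in a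
flat `3`-space has an umbilic. -/
theorem IsothermalSurface.umbilic_of_isLocalMax
    (S : IsothermalSurface G Ω u ν roundFactor U (stdVec 0) (stdVec 1))
    (hdim : Module.finrank ℝ V = 3) (h0 : (0 : EuclideanSpace ℝ (Fin 2)) ∈ U)
    (hmax : IsLocalMax (fun x => ((sff G u ν (stdVec 0) (stdVec 0) x +
      sff G u ν (stdVec 1) (stdVec 1) x) / roundFactor x) ^ 2) 0) :
    sff G u ν (stdVec 0) (stdVec 0) 0 = sff G u ν (stdVec 1) (stdVec 1) 0 ∧
      sff G u ν (stdVec 0) (stdVec 1) 0 = 0 := by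
  -- reversing the normal makes the mean curvature nonnegative
  wlog hpos : 0 ≤ sff G u ν (stdVec 0) (stdVec 0) 0 + sff G u ν (stdVec 1) (stdVec 1) 0
    generalizing ν
  · have h := this S.neg_normal (by
      simp only [sff_neg]
      convert hmax using 1
      funext x
      ring) (by simp only [sff_neg]; linarith)
    simpa only [sff_neg, neg_inj, neg_eq_zero] using h
  have hL := S.smooth_sff h0 (stdVec 0) (stdVec 0)
  have hM := S.smooth_sff h0 (stdVec 0) (stdVec 1)
  have hN := S.smooth_sff h0 (stdVec 1) (stdVec 1)
  have hgauss : ∀ x ∈ U, _ := fun x hx => S.gauss_round hdim hx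
  have hcod₁ : ∀ x ∈ U, _ := fun x hx => S.codazzi₁ hdim hx
  have hcod₂ : ∀ x ∈ U, _ := fun x hx => S.codazzi₂ hdim hx
  set L := sff G u ν (stdVec 0) (stdVec 0)
  set M := sff G u ν (stdVec 0) (stdVec 1)
  set N := sff G u ν (stdVec 1) (stdVec 1)
  have hlam : ContDiffAt ℝ ∞ roundFactor 0 := contDiff_roundFactor.contDiffAt
  have hUn := S.isOpen.mem_nhds h0
  let H : EuclideanSpace ℝ (Fin 2) → ℝ := fun x => (L x + N x) / (2 * roundFactor x)
  let A : EuclideanSpace ℝ (Fin 2) → ℝ := fun x => (L x - N x) / 2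
  have hHs : ContDiffAt ℝ ∞ H 0 := (hL.add hN).div (contDiffAt_const.mul hlam)
    (by simp [roundFactor_zero])
  have hAs : ContDiffAt ℝ ∞ A 0 := (hL.sub hN).div_const 2
  have hgauss0 := hgauss 0 h0
  rw [roundFactor_zero] at hgauss0
  have hsum : 0 < L 0 + N 0 := by
    -- it does not vanish, since the determinant of the second fundamental form is positive
    refine lt_of_le_of_ne hpos fun h => ?_
    rw [show N 0 = - L 0 by linarith] at hgauss0
    nlinarith [sq_nonneg (M 0), sq_nonneg (L 0)]
  have hH0 : 0 < H 0 := div_pos hsum (by simp [roundFactor_zero])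
  have hHmax : IsLocalMax H 0 := by
    filter_upwards [hmax] with y hy
    have e : ∀ z, (L z + N z) / roundFactor z = 2 * H z := fun z => by
      have := (roundFactor_pos z).ne'
      simp only [H]
      field_simp
    rw [e, e] at hy
    by_contra! hlt
    nlinarith
  -- the derivatives of `L + N = 2 * roundFactor * H` and of `L - N = 2 * A`
  have hder : ∀ᶠ y in nhds (0 : EuclideanSpace ℝ (Fin 2)), y ∈ U ∧ ∀ a,
      (fderiv ℝ L y a + fderiv ℝ N y a = 2 * (fderiv ℝ roundFactor y a * H y +
        roundFactor y * fderiv ℝ H y a)) ∧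
      fderiv ℝ A y a = (fderiv ℝ L y a - fderiv ℝ N y a) / 2 := by
    filter_upwards [hUn, eventually_differentiableAt hL, eventually_differentiableAt hN,
      eventually_differentiableAt hHs, eventually_differentiableAt hlam] with y hy dL dN dH dl
    refine ⟨hy, fun a => ⟨?_, ?_⟩⟩
    · have h1 := dL.hasFDerivAt.add dN.hasFDerivAt
      have h2 := (dl.hasFDerivAt.mul dH.hasFDerivAt).const_mul 2
      have h3 := h1.unique (h2.congr_of_eventuallyEq (Filter.Eventually.of_forall fun z => by
        have := (roundFactor_pos z).ne'
        simp only [H, Pi.add_apply, Pi.mul_apply]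
        field_simp))
      have h4 := congrArg (fun φ : EuclideanSpace ℝ (Fin 2) →L[ℝ] ℝ => φ a) h3
      simp at h4
      linarith
    · have h1 : HasFDerivAt A ((2 : ℝ)⁻¹ • (fderiv ℝ L y - fderiv ℝ N y)) y := by
        have h2 := (dL.hasFDerivAt.sub dN.hasFDerivAt).const_smul (2 : ℝ)⁻¹
        refine h2.congr_of_eventuallyEq (Filter.Eventually.of_forall fun z => ?_)
        simp only [A, Pi.sub_apply, Pi.smul_apply, smul_eq_mul]
        ring
      rw [h1.fderiv]
      simp
      ring
  have hquot : ∀ y, ∀ c : ℝ, c * (L y + N y) / (2 * roundFactor y) = c * H y := fun y c => by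
    simp only [H, mul_div_assoc]
  have hmain := FlatImmersion.umbilic_of_isLocalMax (lam := roundFactor) (H := H) (A := A) (M := M)
    (x := 0) (e₁ := stdVec 0) (e₂ := stdVec 1) hlam hHs hAs hM
    (by
      filter_upwards [hder] with y hy
      have h1 := hcod₂ y hy.1
      obtain ⟨h2, h3⟩ := hy.2 (stdVec 0)
      rw [hquot] at h1
      linarith)
    (by
      filter_upwards [hder] with y hy
      have h1 := hcod₁ y hy.1
      obtain ⟨h2, h3⟩ := hy.2 (stdVec 1)
      rw [hquot] at h1
      linarith)
    (by
      filter_upwards [hUn] with y hy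
      have h1 := hgauss y hy
      have h2 : roundFactor y * H y = (L y + N y) / 2 := by
        have := (roundFactor_pos y).ne'
        simp only [H]
        field_simp
      have h3 : roundFactor y ^ 2 * (H y ^ 2 - 1) =
        (roundFactor y * H y) ^ 2 - roundFactor y ^ 2 := by ring
      rw [h3, h2, ← h1]
      simp only [A]
      ring)
    roundFactor_zero (by simp [fderiv_roundFactor]) (by simp [fderiv_roundFactor])
    (by
      have h1 := fderiv_fderiv_roundFactor 0 (stdVec 0)
      have h2 := (differentiableAt_fderiv hlam).hasFDerivAt.clm_apply
        (hasFDerivAt_const (stdVec 0) 0)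
      rw [h2.fderiv] at h1
      norm_num at h1
      simpa using h1)
    (by
      have h1 := fderiv_fderiv_roundFactor 0 (stdVec 1)
      have h2 := (differentiableAt_fderiv hlam).hasFDerivAt.clm_apply
        (hasFDerivAt_const (stdVec 1) 0)
      rw [h2.fderiv] at h1
      norm_num at h1
      simpa using h1)
    hH0 hHmax
  refine ⟨?_, hmain.2⟩
  have := hmain.1
  simp only [A] at this
  linarith

end round

/-! ### The squared mean curvature of an immersed sphere -/

open IsothermalSurface

/-- If the rows `(α, β)` and `(γ, δ)` are orthogonal of squared length `c`, so are the columns. -/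
theorem columns_of_rows {α β γ δ c : ℝ} (hc : 0 < c) (h1 : α ^ 2 + β ^ 2 = c)
    (h2 : γ ^ 2 + δ ^ 2 = c) (h3 : α * γ + β * δ = 0) :
    α ^ 2 + γ ^ 2 = c ∧ β ^ 2 + δ ^ 2 = c ∧ α * β + γ * δ = 0 := by
  have hD : (α * δ - β * γ) ^ 2 = c ^ 2 := by
    linear_combination (γ ^ 2 + δ ^ 2) * h1 + c * h2 - (α * γ + β * δ) * h3
  have hδ : α * (α * δ - β * γ) = c * δ := by linear_combination δ * h1 - β * h3
  have hγ : β * (α * δ - β * γ) = - (c * γ) := by linear_combination (-γ) * h1 + α * h3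
  have hc2 : c ^ 2 ≠ 0 := by positivity
  refine ⟨?_, ?_, ?_⟩
  · refine mul_left_cancel₀ hc2 ?_
    linear_combination (c * γ - β * (α * δ - β * γ)) * hγ + β ^ 2 * hD + c ^ 2 * h1
  · refine mul_left_cancel₀ hc2 ?_
    linear_combination (-(c * δ) - α * (α * δ - β * γ)) * hδ + α ^ 2 * hD + c ^ 2 * h1
  · refine mul_left_cancel₀ hc2 ?_
    linear_combination (c * δ) * hγ + β * (α * δ - β * γ) * hδ - α * β * hD

/-- The squared length of the trace of the second fundamental form does not depend on the
coordinates: `u₂ = τ ∘ u₁ ∘ σ` for a change of parameters `σ` and an isometry `τ`. The coordinates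
`u₂` are assumed to be normalized at the point `s`. -/
theorem apply_hess_trace_eq {V : Type*} [NormedAddCommGroup V] [NormedSpace ℝ V]
    [FiniteDimensional ℝ V] (hdim : Module.finrank ℝ V = 3)
    {G₁ G₂ : V → V →L[ℝ] V →L[ℝ] ℝ} {Ω₁ Ω₂ : Set V}
    {u₁ u₂ ν₁ ν₂ : EuclideanSpace ℝ (Fin 2) → V} {lam₁ lam₂ : EuclideanSpace ℝ (Fin 2) → ℝ}
    {U₁ U₂ : Set (EuclideanSpace ℝ (Fin 2))}
    (S₁ : IsothermalSurface G₁ Ω₁ u₁ ν₁ lam₁ U₁ (stdVec 0) (stdVec 1))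
    (S₂ : IsothermalSurface G₂ Ω₂ u₂ ν₂ lam₂ U₂ (stdVec 0) (stdVec 1))
    {σ : EuclideanSpace ℝ (Fin 2) → EuclideanSpace ℝ (Fin 2)} {τ : V → V}
    {s : EuclideanSpace ℝ (Fin 2)} (hs : s ∈ U₂) (hσU : σ s ∈ U₁) (hlam₂ : lam₂ s = 1)
    (hσ : ContDiffAt ℝ ∞ σ s) (hτ : ContDiffAt ℝ ∞ τ (u₁ (σ s)))
    (heq : u₂ =ᶠ[nhds s] fun t => τ (u₁ (σ t)))
    (hiso : ∀ᶠ y in nhds (u₁ (σ s)),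
      ∀ v w, G₁ y v w = G₂ (τ y) (fderiv ℝ τ y v) (fderiv ℝ τ y w)) :
    G₂ (u₂ s) (hess G₂ u₂ s (stdVec 0) (stdVec 0) + hess G₂ u₂ s (stdVec 1) (stdVec 1))
        (hess G₂ u₂ s (stdVec 0) (stdVec 0) + hess G₂ u₂ s (stdVec 1) (stdVec 1)) =
      ((sff G₁ u₁ ν₁ (stdVec 0) (stdVec 0) (σ s) + sff G₁ u₁ ν₁ (stdVec 1) (stdVec 1) (σ s)) /
        lam₁ (σ s)) ^ 2 := by
  have hus := S₁.smooth _ hσU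
  have hτu : τ (u₁ (σ s)) = u₂ s := heq.self_of_nhds.symm
  have hiso0 := hiso.self_of_nhds
  rw [hτu] at hiso0
  set x := σ s
  -- the transformation of first and second derivatives
  have hd1 : ∀ a, fderiv ℝ u₂ s a = fderiv ℝ τ (u₁ x) (fderiv ℝ u₁ x (fderiv ℝ σ s a)) := by
    intro a
    have h1 : HasFDerivAt (fun t => u₁ (σ t)) (fderiv ℝ u₁ x ∘L fderiv ℝ σ s) s :=
      HasFDerivAt.comp s (hus.differentiableAt (by simp)).hasFDerivAt
        (hσ.differentiableAt (by simp)).hasFDerivAt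
    have h2 : HasFDerivAt (fun t => τ (u₁ (σ t)))
        (fderiv ℝ τ (u₁ x) ∘L (fderiv ℝ u₁ x ∘L fderiv ℝ σ s)) s :=
      HasFDerivAt.comp (g := τ) (f := fun t => u₁ (σ t)) s
        (hτ.differentiableAt (by simp)).hasFDerivAt h1
    rw [heq.fderiv_eq, h2.fderiv]
    rfl
  have hd2 : ∀ a, hess G₂ u₂ s a a = fderiv ℝ τ (u₁ x) (hess G₁ u₁ x (fderiv ℝ σ s a)
      (fderiv ℝ σ s a) + fderiv ℝ u₁ x (fderiv ℝ (fderiv ℝ σ) s a a)) := by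
    intro a
    rw [hess_congr heq, hess_comp_left S₁.metric S₂.metric (u := fun t => u₁ (σ t))
      (S₁.mapsTo _ hσU) (by rw [hτu]; exact S₂.mapsTo s hs)
      (ContDiffAt.comp (g := u₁) s hus hσ) hτ hiso, hess_comp_right hus hσ]
  set s₀ := fderiv ℝ σ s (stdVec 0) with hs₀
  set s₁ := fderiv ℝ σ s (stdVec 1) with hs₁
  set h' := (hess G₁ u₁ x s₀ s₀ + fderiv ℝ u₁ x (fderiv ℝ (fderiv ℝ σ) s (stdVec 0) (stdVec 0))) +
    (hess G₁ u₁ x s₁ s₁ + fderiv ℝ u₁ x (fderiv ℝ (fderiv ℝ σ) s (stdVec 1) (stdVec 1))) with hh'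
  have hτh : hess G₂ u₂ s (stdVec 0) (stdVec 0) + hess G₂ u₂ s (stdVec 1) (stdVec 1) =
      fderiv ℝ τ (u₁ x) h' := by
    rw [hd2, hd2, ← map_add]
  -- the trace of the Hessian is normal, since isothermal coordinates are harmonic
  have htan := S₂.hess_tangential hs
  have hn0 : G₁ (u₁ x) h' (fderiv ℝ u₁ x s₀) = 0 := by
    rw [hiso0, ← hτh, hs₀, ← hd1, map_add, add_apply, htan.1, htan.2.2.2.2.1]
    ring
  have hn1 : G₁ (u₁ x) h' (fderiv ℝ u₁ x s₁) = 0 := by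
    rw [hiso0, ← hτh, hs₁, ← hd1, map_add, add_apply, htan.2.1, htan.2.2.2.2.2]
    ring
  -- the differential of the change of parameters is conformal
  have hlin : ∀ a : EuclideanSpace ℝ (Fin 2), fderiv ℝ u₁ x a =
      a 0 • fderiv ℝ u₁ x (stdVec 0) + a 1 • fderiv ℝ u₁ x (stdVec 1) := fun a => by
    rw [← map_smul, ← map_smul, ← map_add, ← eq_stdVec]
  have hg : ∀ a b : EuclideanSpace ℝ (Fin 2), G₁ (u₁ x) (fderiv ℝ u₁ x a) (fderiv ℝ u₁ x b) =
      lam₁ x * (a 0 * b 0 + a 1 * b 1) := by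
    intro a b
    rw [hlin a, hlin b]
    simp only [map_add, map_smul, add_apply, smul_apply, S₁.g11 x hσU, S₁.g22 x hσU, S₁.g12 x hσU,
      S₁.symm hσU (fderiv ℝ u₁ x (stdVec 1)) (fderiv ℝ u₁ x (stdVec 0)), smul_eq_mul]
    ring
  have c00 := hg s₀ s₀
  have c11 := hg s₁ s₁
  have c01 := hg s₀ s₁
  rw [hiso0, hs₀, ← hd1, ← hs₀, S₂.g11 s hs, hlam₂] at c00
  rw [hiso0, hs₁, ← hd1, ← hs₁, S₂.g22 s hs, hlam₂] at c11
  rw [hiso0, hs₁, hs₀, ← hd1, ← hd1, ← hs₀, ← hs₁, S₂.g12 s hs] at c01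
  have hlam := S₁.lam_pos x hσU
  have hinv : (lam₁ x)⁻¹ ≠ 0 := (inv_pos.2 hlam).ne'
  obtain ⟨k1, k2, k3⟩ := columns_of_rows (α := s₀ 0) (β := s₀ 1) (γ := s₁ 0) (δ := s₁ 1)
    (c := (lam₁ x)⁻¹) (inv_pos.2 hlam) (by field_simp; linarith) (by field_simp; linarith)
    ((mul_eq_zero.1 c01.symm).resolve_left hlam.ne')
  rw [hlin, map_add, map_smul, map_smul, smul_eq_mul, smul_eq_mul] at hn0 hn1
  have ht1 : G₁ (u₁ x) h' (fderiv ℝ u₁ x (stdVec 0)) = 0 := by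
    refine (mul_eq_zero.1 ?_).resolve_left hinv
    rw [← k1]
    linear_combination s₀ 0 * hn0 + s₁ 0 * hn1 - G₁ (u₁ x) h' (fderiv ℝ u₁ x (stdVec 1)) * k3
  have ht2 : G₁ (u₁ x) h' (fderiv ℝ u₁ x (stdVec 1)) = 0 := by
    refine (mul_eq_zero.1 ?_).resolve_left hinv
    rw [← k2]
    linear_combination s₀ 1 * hn0 + s₁ 1 * hn1 - G₁ (u₁ x) h' (fderiv ℝ u₁ x (stdVec 0)) * k3
  have hnormal : ∀ a, G₁ (u₁ x) (fderiv ℝ u₁ x a) (ν₁ x) = 0 := by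
    intro a
    rw [hlin]
    simp only [map_add, map_smul, add_apply, smul_apply, S₁.normal₁ x hσU, S₁.normal₂ x hσU,
      smul_zero, add_zero]
  have hνcomp : G₁ (u₁ x) h' (ν₁ x) = (sff G₁ u₁ ν₁ (stdVec 0) (stdVec 0) x +
      sff G₁ u₁ ν₁ (stdVec 1) (stdVec 1) x) / lam₁ x := by
    have e0 := S₁.sff_combination hσU (s₀ 0) (s₀ 1) (s₀ 0) (s₀ 1)
    have e1 := S₁.sff_combination hσU (s₁ 0) (s₁ 1) (s₁ 0) (s₁ 1)
    rw [← eq_stdVec] at e0 e1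
    rw [hh']
    simp only [map_add, add_apply, hnormal, add_zero]
    change sff G₁ u₁ ν₁ s₀ s₀ x + sff G₁ u₁ ν₁ s₁ s₁ x = _
    rw [e0, e1, div_eq_mul_inv]
    linear_combination sff G₁ u₁ ν₁ (stdVec 0) (stdVec 0) x * k1 +
      sff G₁ u₁ ν₁ (stdVec 1) (stdVec 1) x * k2 + 2 * sff G₁ u₁ ν₁ (stdVec 0) (stdVec 1) x * k3
  rw [hτh, ← hiso0, S₁.apply_eq hdim hσU, ht1, ht2, hνcomp]
  ring

section immersion

variable {M : Type*} [TopologicalSpace M] [ChartedSpace (EuclideanSpace ℝ (Fin 3)) M]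
  [IsManifold (𝓡 3) ∞ M] {g : RiemMetric 3 M} {F : S2 → M}

/-- The set of parameters at which the local expression of `F` around `p` is meaningful. -/
def chartDomain (F : S2 → M) (p : S2) : Set (EuclideanSpace ℝ (Fin 2)) :=
  {x | F ((extChartAt (𝓡 2) p).symm x) ∈ (extChartAt (𝓡 3) (F p)).source}

/-- The local expression of `F` around `p`, restricted to `U`, as a parametrized surface. -/
abbrev IsLocalSurface (g : RiemMetric 3 M) (F : S2 → M) (p : S2)
    (ν : EuclideanSpace ℝ (Fin 2) → EuclideanSpace ℝ (Fin 3))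
    (U : Set (EuclideanSpace ℝ (Fin 2))) : Prop :=
  IsothermalSurface (chartMetric g (F p)) (extChartAt (𝓡 3) (F p)).target (localExpr F p) ν
    roundFactor U (stdVec 0) (stdVec 1)

theorem mem_sphere_target (p : S2) (x : EuclideanSpace ℝ (Fin 2)) :
    x ∈ (extChartAt (𝓡 2) p).target := by
  rw [extChartAt_sphere_target]
  trivial

theorem extChartAt_sphere_symm_zero (p : S2) : (extChartAt (𝓡 2) p).symm 0 = p := by
  rw [← extChartAt_sphere_self p]
  exact extChartAt_to_inv p

theorem continuous_sphere_symm (p : S2) : Continuous (extChartAt (𝓡 2) p).symm := by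
  have h := continuousOn_extChartAt_symm (I := 𝓡 2) p
  rwa [extChartAt_sphere_target, continuousOn_univ] at h

theorem zero_mem_chartDomain (F : S2 → M) (p : S2) :
    (0 : EuclideanSpace ℝ (Fin 2)) ∈ chartDomain F p := by
  rw [chartDomain, Set.mem_ofPred_eq, extChartAt_sphere_symm_zero]
  exact mem_extChartAt_source (F p)

theorem localExpr_zero (F : S2 → M) (p : S2) :
    localExpr (n := 3) F p 0 = extChartAt (𝓡 3) (F p) (F p) := by
  rw [localExpr, extChartAt_sphere_symm_zero]

theorem isOpen_chartDomain (hF : Continuous F) (p : S2) : IsOpen (chartDomain F p) :=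
  (isOpen_extChartAt_source (F p)).preimage (hF.comp (continuous_sphere_symm p))

theorem contMDiffAt_comp_symm (hF : ContMDiff (𝓡 2) (𝓡 3) ∞ F) (p : S2)
    (x : EuclideanSpace ℝ (Fin 2)) : ContMDiffAt 𝓘(ℝ, EuclideanSpace ℝ (Fin 2)) (𝓡 3) ∞
      (fun x => F ((extChartAt (𝓡 2) p).symm x)) x :=
  ContMDiffAt.comp x (hF _) (contMDiffAt_extChartAt_symm (mem_sphere_target p x))

theorem contDiffAt_localExpr (hF : ContMDiff (𝓡 2) (𝓡 3) ∞ F) {p : S2}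
    {x : EuclideanSpace ℝ (Fin 2)} (hx : x ∈ chartDomain F p) :
    ContDiffAt ℝ ∞ (localExpr (n := 3) F p) x :=
  contDiffAt_extChartAt_comp (contMDiffAt_comp_symm hF p x) hx

/-- The local expressions of an isometric immersion of the round sphere are conformal. -/
theorem chartMetric_fderiv_localExpr (hF : IsIsometricImmersion g F) {p : S2}
    {x : EuclideanSpace ℝ (Fin 2)} (hx : x ∈ chartDomain F p) (a b : EuclideanSpace ℝ (Fin 2)) :
    chartMetric g (F p) (localExpr F p x) (fderiv ℝ (localExpr F p) x a)
      (fderiv ℝ (localExpr F p) x b) = roundFactor x * inner ℝ a b := by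
  have h1 := chartMetric_fderiv g
    ((contMDiffAt_comp_symm hF.1 p x).mdifferentiableAt (by simp)) hx a b
  have h2 := mfderiv_comp x ((hF.1 ((extChartAt (𝓡 2) p).symm x)).mdifferentiableAt (by simp))
    ((contMDiffAt_extChartAt_symm (mem_sphere_target p x)).mdifferentiableAt (by simp))
  have h2' : mfderiv 𝓘(ℝ, EuclideanSpace ℝ (Fin 2)) (𝓡 3)
      (fun x => F ((extChartAt (𝓡 2) p).symm x)) x = _ := h2
  rw [h2'] at h1
  refine h1.trans ((hF.2 _ _ _).trans ?_)
  exact roundMetric_extChartAt_symm p x a b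

theorem exists_isLocalSurface (hg : IsFlat g) (hF : IsIsometricImmersion g F) {p : S2}
    {x₀ : EuclideanSpace ℝ (Fin 2)} (hx₀ : x₀ ∈ chartDomain F p) :
    ∃ ν U, x₀ ∈ U ∧ U ⊆ chartDomain F p ∧ IsLocalSurface g F p ν U := by
  refine exists_isothermalSurface finrank_euclideanSpace_fin (isMetricOn_chartMetric g (F p))
    (fun y hy => hg (F p) y hy) (isOpen_chartDomain hF.1.continuous p)
    (fun x hx => (extChartAt (𝓡 3) (F p)).map_source hx)
    (fun x hx => contDiffAt_localExpr hF.1 hx) (fun x _ => contDiff_roundFactor.contDiffAt)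
    (fun x _ => roundFactor_pos x) (fun x hx => ?_) (fun x hx => ?_) (fun x hx => ?_) hx₀ <;>
  · refine (chartMetric_fderiv_localExpr hF hx _ _).trans ?_
    simp [inner_plane]

/-- Four times the squared length of the mean curvature vector of `F` at `p`, that is, the squared
length of the trace of the second fundamental form. It is computed in the charts around `p` and
`F p`, the first of which is an isometry to first order at `p`. Unlike the mean curvature itself, it
needs no choice of a normal field, hence no orientation of `M`. -/
def meanCurvatureSq (g : RiemMetric 3 M) (F : S2 → M) (p : S2) : ℝ :=
  chartMetric g (F p) (localExpr F p 0)
    (hess (chartMetric g (F p)) (localExpr F p) 0 (stdVec 0) (stdVec 0) +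
      hess (chartMetric g (F p)) (localExpr F p) 0 (stdVec 1) (stdVec 1))
    (hess (chartMetric g (F p)) (localExpr F p) 0 (stdVec 0) (stdVec 0) +
      hess (chartMetric g (F p)) (localExpr F p) 0 (stdVec 1) (stdVec 1))

/-- Near `p`, the squared mean curvature, defined at each point `q` in the charts around `q`, is
given by the trace of the second fundamental form in the charts around `p`. -/
theorem meanCurvatureSq_eq (hg : IsFlat g) (hF : IsIsometricImmersion g F) {p : S2}
    {ν : EuclideanSpace ℝ (Fin 2) → EuclideanSpace ℝ (Fin 3)}
    {U : Set (EuclideanSpace ℝ (Fin 2))} (S : IsLocalSurface g F p ν U) (hU : U ⊆ chartDomain F p)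
    {q : S2} (hq : q ∈ (extChartAt (𝓡 2) p).source) (hqU : extChartAt (𝓡 2) p q ∈ U) :
    meanCurvatureSq g F q =
      ((sff (chartMetric g (F p)) (localExpr F p) ν (stdVec 0) (stdVec 0) (extChartAt (𝓡 2) p q) +
        sff (chartMetric g (F p)) (localExpr F p) ν (stdVec 1) (stdVec 1)
          (extChartAt (𝓡 2) p q)) / roundFactor (extChartAt (𝓡 2) p q)) ^ 2 := by
  -- the transition maps of the sphere and of `M`
  let σ : EuclideanSpace ℝ (Fin 2) → EuclideanSpace ℝ (Fin 2) := fun t =>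
    extChartAt (𝓡 2) p ((extChartAt (𝓡 2) q).symm t)
  let τ : EuclideanSpace ℝ (Fin 3) → EuclideanSpace ℝ (Fin 3) := fun y =>
    extChartAt (𝓡 3) (F q) ((extChartAt (𝓡 3) (F p)).symm y)
  have hσ0 : σ 0 = extChartAt (𝓡 2) p q := by
    simp only [σ, extChartAt_sphere_symm_zero]
  have hxq : (extChartAt (𝓡 2) p).symm (extChartAt (𝓡 2) p q) = q :=
    (extChartAt (𝓡 2) p).left_inv hq
  have hFq : F q ∈ (extChartAt (𝓡 3) (F p)).source := by
    have := hU hqU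
    rwa [chartDomain, Set.mem_ofPred_eq, hxq] at this
  have huT : localExpr F p (σ 0) ∈ (extChartAt (𝓡 3) (F p)).target := by
    rw [hσ0]
    exact S.mapsTo _ hqU
  have hinv : (extChartAt (𝓡 3) (F p)).symm (localExpr F p (σ 0)) = F q := by
    rw [hσ0, localExpr, hxq]
    exact (extChartAt (𝓡 3) (F p)).left_inv hFq
  have hσs : ContDiffAt ℝ ∞ σ 0 :=
    contDiffAt_extChartAt_comp (contMDiffAt_extChartAt_symm (mem_sphere_target q 0))
      (by rwa [extChartAt_sphere_symm_zero])
  have hτs : ContDiffAt ℝ ∞ τ (localExpr F p (σ 0)) :=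
    contDiffAt_extChartAt_comp (contMDiffAt_extChartAt_symm huT)
      (by rw [hinv]; exact mem_extChartAt_source (F q))
  have heq : localExpr (n := 3) F q =ᶠ[nhds 0] fun t => τ (localExpr F p (σ t)) := by
    have hc := (continuous_sphere_symm q).continuousAt (x := 0)
    have hcF := (hF.1.continuous.comp (continuous_sphere_symm q)).continuousAt (x := 0)
    filter_upwards [hc.eventually ((isOpen_extChartAt_source (I := 𝓡 2) p).mem_nhds
        (by rwa [extChartAt_sphere_symm_zero])),
      hcF.eventually ((isOpen_extChartAt_source (I := 𝓡 3) (F p)).mem_nhds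
        (by rwa [Function.comp_apply, extChartAt_sphere_symm_zero]))] with t ht ht'
    have ht'' : F ((extChartAt (𝓡 2) q).symm t) ∈ (extChartAt (𝓡 3) (F p)).source := ht'
    simp only [τ, σ, localExpr]
    rw [(extChartAt (𝓡 2) p).left_inv ht, (extChartAt (𝓡 3) (F p)).left_inv ht'']
  have hiso : ∀ᶠ y in nhds (localExpr F p (σ 0)), ∀ v w, chartMetric g (F p) y v w =
      chartMetric g (F q) (τ y) (fderiv ℝ τ y v) (fderiv ℝ τ y w) := by
    filter_upwards [(isOpen_extChartAt_target (F p)).mem_nhds huT,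
      (contMDiffAt_extChartAt_symm huT).continuousAt.eventually
        ((isOpen_extChartAt_source (I := 𝓡 3) (F q)).mem_nhds (by
          rw [hinv]; exact mem_extChartAt_source (F q)))] with y hy hy' v w
    exact chartMetric_transition g hy hy' v w
  obtain ⟨νq, Uq, h0q, -, Sq⟩ := exists_isLocalSurface hg hF (zero_mem_chartDomain F q)
  have h := apply_hess_trace_eq finrank_euclideanSpace_fin S Sq h0q (by rwa [hσ0])
    roundFactor_zero hσs hτs heq hiso
  rw [hσ0] at h
  exact h

theorem extChartAt_sphere_symm_mem_source (p : S2) (x : EuclideanSpace ℝ (Fin 2)) :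
    (extChartAt (𝓡 2) p).symm x ∈ (extChartAt (𝓡 2) p).source :=
  (extChartAt (𝓡 2) p).map_target (mem_sphere_target p x)

theorem extChartAt_sphere_right_inv (p : S2) (x : EuclideanSpace ℝ (Fin 2)) :
    extChartAt (𝓡 2) p ((extChartAt (𝓡 2) p).symm x) = x :=
  (extChartAt (𝓡 2) p).right_inv (mem_sphere_target p x)

theorem meanCurvatureSq_self (hg : IsFlat g) (hF : IsIsometricImmersion g F) {p : S2}
    {ν : EuclideanSpace ℝ (Fin 2) → EuclideanSpace ℝ (Fin 3)}
    {U : Set (EuclideanSpace ℝ (Fin 2))} (S : IsLocalSurface g F p ν U) (hU : U ⊆ chartDomain F p)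
    (h0 : (0 : EuclideanSpace ℝ (Fin 2)) ∈ U) :
    meanCurvatureSq g F p =
      (sff (chartMetric g (F p)) (localExpr F p) ν (stdVec 0) (stdVec 0) 0 +
        sff (chartMetric g (F p)) (localExpr F p) ν (stdVec 1) (stdVec 1) 0) ^ 2 := by
  have h := meanCurvatureSq_eq hg hF S hU (q := p) (mem_extChartAt_source p)
    (by rwa [extChartAt_sphere_self])
  rwa [extChartAt_sphere_self, roundFactor_zero, div_one] at h

theorem continuous_meanCurvatureSq (hg : IsFlat g) (hF : IsIsometricImmersion g F) :
    Continuous (meanCurvatureSq g F) := by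
  refine continuous_iff_continuousAt.2 fun p => ?_
  obtain ⟨ν, U, h0, hU, S⟩ := exists_isLocalSurface hg hF (zero_mem_chartDomain F p)
  have hχ : ContinuousAt (extChartAt (𝓡 2) p) p := continuousAt_extChartAt p
  have hev : ∀ᶠ q in nhds p, q ∈ (extChartAt (𝓡 2) p).source ∧ extChartAt (𝓡 2) p q ∈ U :=
    Filter.Eventually.and (extChartAt_source_mem_nhds (I := 𝓡 2) p)
      (hχ.eventually (S.isOpen.mem_nhds (by rwa [extChartAt_sphere_self])))
  have hc : ContinuousAt (fun x =>
      ((sff (chartMetric g (F p)) (localExpr F p) ν (stdVec 0) (stdVec 0) x +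
        sff (chartMetric g (F p)) (localExpr F p) ν (stdVec 1) (stdVec 1) x) /
          roundFactor x) ^ 2) (extChartAt (𝓡 2) p p) := by
    rw [extChartAt_sphere_self]
    exact (((S.smooth_sff h0 _ _).continuousAt.add (S.smooth_sff h0 _ _).continuousAt).div
      contDiff_roundFactor.continuous.continuousAt (roundFactor_pos 0).ne').pow 2
  refine (ContinuousAt.comp hc hχ).congr ?_
  filter_upwards [hev] with q hq
  exact (meanCurvatureSq_eq hg hF S hU hq.1 hq.2).symm

/-- By the maximum principle, the mean curvature of `F` is at most `1` in absolute value. -/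
theorem meanCurvatureSq_le (hg : IsFlat g) (hF : IsIsometricImmersion g F) (p : S2) :
    meanCurvatureSq g F p ≤ 4 := by
  obtain ⟨p₀, -, hmax⟩ := isCompact_univ.exists_isMaxOn (s := (Set.univ : Set S2)) ⟨p, trivial⟩
    (continuous_meanCurvatureSq hg hF).continuousOn
  obtain ⟨ν, U, h0, hU, S⟩ := exists_isLocalSurface hg hF (zero_mem_chartDomain F p₀)
  have hloc : IsLocalMax (fun x =>
      ((sff (chartMetric g (F p₀)) (localExpr F p₀) ν (stdVec 0) (stdVec 0) x +
        sff (chartMetric g (F p₀)) (localExpr F p₀) ν (stdVec 1) (stdVec 1) x) /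
          roundFactor x) ^ 2) 0 := by
    have hval : ∀ x ∈ U, _ := fun x hx => meanCurvatureSq_eq hg hF S hU
      (extChartAt_sphere_symm_mem_source p₀ x) (by rwa [extChartAt_sphere_right_inv])
    simp only [extChartAt_sphere_right_inv] at hval
    filter_upwards [S.isOpen.mem_nhds h0] with x hx
    rw [← hval x hx, ← hval 0 h0, extChartAt_sphere_symm_zero]
    exact hmax (Set.mem_univ _)
  obtain ⟨h1, h2⟩ := S.umbilic_of_isLocalMax finrank_euclideanSpace_fin h0 hloc
  have h3 := S.gauss_round finrank_euclideanSpace_fin h0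
  rw [h1, h2, roundFactor_zero] at h3
  refine (hmax (Set.mem_univ p)).trans ?_
  rw [meanCurvatureSq_self hg hF S hU h0, h1]
  nlinarith

/-- The second fundamental form of `F` in terms of the Hessian of the local expression. -/
theorem secondFundForm_eq (F : S2 → M) (p : S2) (ν : TangentSpace (𝓡 3) (F p))
    (v w : TangentSpace (𝓡 2) p) :
    secondFundForm g F p ν v w = chartMetric g (F p) (localExpr F p 0)
      (hess (chartMetric g (F p)) (localExpr F p) 0
        (mfderiv (𝓡 2) 𝓘(ℝ, EuclideanSpace ℝ (Fin 2)) (extChartAt (𝓡 2) p) p v)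
        (mfderiv (𝓡 2) 𝓘(ℝ, EuclideanSpace ℝ (Fin 2)) (extChartAt (𝓡 2) p) p w))
      (mfderiv (𝓡 3) 𝓘(ℝ, EuclideanSpace ℝ (Fin 3)) (extChartAt (𝓡 3) (F p)) (F p) ν) := by
  unfold secondFundForm covDerivAlong hess
  rw [localExpr_zero, extChartAt_sphere_self]

/-- The differential of the local expression is the differential of `F`, read in the charts. -/
theorem fderiv_localExpr_zero (hF : ContMDiff (𝓡 2) (𝓡 3) ∞ F) (p : S2)
    (v : TangentSpace (𝓡 2) p) :
    fderiv ℝ (localExpr F p) 0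
      (mfderiv (𝓡 2) 𝓘(ℝ, EuclideanSpace ℝ (Fin 2)) (extChartAt (𝓡 2) p) p v) =
    mfderiv (𝓡 3) 𝓘(ℝ, EuclideanSpace ℝ (Fin 3)) (extChartAt (𝓡 3) (F p)) (F p)
      (mfderiv (𝓡 2) (𝓡 3) F p v) := by
  have hM := isManifold_one (n := 3) (M := M)
  have hS := isManifold_one (n := 2) (M := S2)
  have hφ : MDifferentiableAt (𝓡 3) 𝓘(ℝ, EuclideanSpace ℝ (Fin 3)) (extChartAt (𝓡 3) (F p))
    (F p) := mdifferentiableAt_extChartAt (mem_chart_source _ _)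
  have hχ : MDifferentiableAt (𝓡 2) 𝓘(ℝ, EuclideanSpace ℝ (Fin 2)) (extChartAt (𝓡 2) p) p :=
    mdifferentiableAt_extChartAt (mem_chart_source _ _)
  have hFp : MDifferentiableAt (𝓡 2) (𝓡 3) F p := (hF p).mdifferentiableAt (by simp)
  have hu : MDifferentiableAt 𝓘(ℝ, EuclideanSpace ℝ (Fin 2)) 𝓘(ℝ, EuclideanSpace ℝ (Fin 3))
      (localExpr (n := 3) F p) (extChartAt (𝓡 2) p p) := by
    rw [extChartAt_sphere_self]
    exact ((contDiffAt_localExpr hF (zero_mem_chartDomain F p)).differentiableAt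
      (by simp)).mdifferentiableAt
  have h1 := mfderiv_comp p hu hχ
  have h2 := mfderiv_comp p hφ hFp
  have heq : (localExpr (n := 3) F p ∘ extChartAt (𝓡 2) p) =ᶠ[nhds p]
      (extChartAt (𝓡 3) (F p) ∘ F) := by
    filter_upwards [extChartAt_source_mem_nhds (I := 𝓡 2) p] with q hq
    simp only [Function.comp_apply, localExpr]
    rw [(extChartAt (𝓡 2) p).left_inv hq]
  have h3 := heq.mfderiv_eq (I := 𝓡 2) (I' := 𝓘(ℝ, EuclideanSpace ℝ (Fin 3)))
  rw [mfderiv_eq_fderiv, extChartAt_sphere_self] at h1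
  have h4 := h1.symm.trans (h3.trans h2)
  exact congrArg (fun φ : EuclideanSpace ℝ (Fin 2) →L[ℝ] EuclideanSpace ℝ (Fin 3) => φ v) h4

/-- At each point the trace of the second fundamental form has square at most `4` and the
determinant is `1`, so that both principal curvatures are equal. -/
theorem isTotallyUmbilical (hg : IsFlat g) (hF : IsIsometricImmersion g F) :
    IsTotallyUmbilical g F := by
  intro p ν hν
  obtain ⟨n, U, h0, hU, S⟩ := exists_isLocalSurface hg hF (zero_mem_chartDomain F p)
  have hdim : Module.finrank ℝ (EuclideanSpace ℝ (Fin 3)) = 3 := finrank_euclideanSpace_fin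
  have hle := meanCurvatureSq_le hg hF p
  have hgauss := S.gauss_round hdim h0
  rw [meanCurvatureSq_self hg hF S hU h0] at hle
  rw [roundFactor_zero] at hgauss
  set L := sff (chartMetric g (F p)) (localExpr F p) n (stdVec 0) (stdVec 0) 0 with hL
  set N := sff (chartMetric g (F p)) (localExpr F p) n (stdVec 1) (stdVec 1) 0 with hN
  set m := sff (chartMetric g (F p)) (localExpr F p) n (stdVec 0) (stdVec 1) 0 with hm
  have hsq : (L - N) ^ 2 + (2 * m) ^ 2 ≤ 0 := by nlinarith
  have hLN : L = N := by nlinarith [sq_nonneg (L - N), sq_nonneg (2 * m)]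
  have hm0 : m = 0 := by nlinarith [sq_nonneg (L - N), sq_nonneg (2 * m)]
  set ν' : EuclideanSpace ℝ (Fin 3) :=
    mfderiv (𝓡 3) 𝓘(ℝ, EuclideanSpace ℝ (Fin 3)) (extChartAt (𝓡 3) (F p)) (F p) ν with hν'
  refine ⟨L * chartMetric g (F p) (localExpr F p 0) ν' (n 0), fun v w => ?_⟩
  set v' : EuclideanSpace ℝ (Fin 2) :=
    mfderiv (𝓡 2) 𝓘(ℝ, EuclideanSpace ℝ (Fin 2)) (extChartAt (𝓡 2) p) p v with hv'
  set w' : EuclideanSpace ℝ (Fin 2) :=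
    mfderiv (𝓡 2) 𝓘(ℝ, EuclideanSpace ℝ (Fin 2)) (extChartAt (𝓡 2) p) p w with hw'
  have hmetric : ∀ a b : TangentSpace (𝓡 3) (F p), chartMetric g (F p) (localExpr F p 0)
      (mfderiv (𝓡 3) 𝓘(ℝ, EuclideanSpace ℝ (Fin 3)) (extChartAt (𝓡 3) (F p)) (F p) a)
      (mfderiv (𝓡 3) 𝓘(ℝ, EuclideanSpace ℝ (Fin 3)) (extChartAt (𝓡 3) (F p)) (F p) b) =
      g.inner (F p) a b := fun a b => by
    rw [localExpr_zero]
    exact chartMetric_mfderiv g (mem_extChartAt_source (F p)) a b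
  have hDu : ∀ a b : EuclideanSpace ℝ (Fin 2), chartMetric g (F p) (localExpr F p 0)
      (fderiv ℝ (localExpr F p) 0 a) (fderiv ℝ (localExpr F p) 0 b) = a 0 * b 0 + a 1 * b 1 := by
    intro a b
    rw [chartMetric_fderiv_localExpr hF (zero_mem_chartDomain F p), roundFactor_zero, one_mul,
      inner_plane]
  -- the coordinate fields are images of tangent vectors of the sphere, hence orthogonal to `ν`
  have hperp : ∀ a : EuclideanSpace ℝ (Fin 2), chartMetric g (F p) (localExpr F p 0)
      ν' (fderiv ℝ (localExpr F p) 0 a) = 0 := by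
    intro a
    have hM := isManifold_one (n := 2) (M := S2)
    obtain ⟨b, rfl⟩ : ∃ b : TangentSpace (𝓡 2) p,
        mfderiv (𝓡 2) 𝓘(ℝ, EuclideanSpace ℝ (Fin 2)) (extChartAt (𝓡 2) p) p b = a :=
      (isInvertible_mfderiv_extChartAt (mem_extChartAt_source p)).bijective.surjective a
    rw [S.symm h0, fderiv_localExpr_zero hF.1, hmetric]
    exact hν b
  have hsff : sff (chartMetric g (F p)) (localExpr F p) n v' w' 0 =
      L * (v' 0 * w' 0 + v' 1 * w' 1) := by
    have h := S.sff_combination h0 (v' 0) (v' 1) (w' 0) (w' 1)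
    rw [← eq_stdVec, ← eq_stdVec] at h
    rw [h, ← hL, ← hN, ← hm, ← hLN, hm0]
    ring
  rw [secondFundForm_eq, ← hmetric, ← fderiv_localExpr_zero hF.1, ← fderiv_localExpr_zero hF.1]
  refine (S.symm h0 _ ν').trans ?_
  change chartMetric g (F p) (localExpr F p 0) ν'
      (hess (chartMetric g (F p)) (localExpr F p) 0 v' w') =
    _ * chartMetric g (F p) (localExpr F p 0) (fderiv ℝ (localExpr F p) 0 v')
      (fderiv ℝ (localExpr F p) 0 w')
  rw [hDu, S.apply_eq hdim h0, hperp, hperp]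
  change _ + _ * sff (chartMetric g (F p)) (localExpr F p) n v' w' 0 = _
  rw [hsff]
  ring


end immersion

end FlatImmersion

end

theorem mainTheorem7 {M : Type*} [TopologicalSpace M]
    [ChartedSpace (EuclideanSpace ℝ (Fin 3)) M] [IsManifold (𝓡 3) ∞ M]
    (g : FlatImmersion.RiemMetric 3 M) (hg : FlatImmersion.IsFlat g)
    (F : FlatImmersion.S2 → M) (hF : FlatImmersion.IsIsometricImmersion g F) :
    FlatImmersion.IsTotallyUmbilical g F :=
  FlatImmersion.isTotallyUmbilical hg hF
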